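/- Let $\tau\in\mathbb{H}$, $\Lambda=\mathbb{Z}\oplus\mathbb{Z}\tau$, $E=\mathbb{C}/\Lambda$ and $\mathrm{vol}=\frac{\mathbf{i}}{2\,\mathrm{im}\,\tau}\,dz\wedge d\bar z$. Let $\theta$ be the odd Jacobi theta function $\vartheta_{(\frac12,\frac12)}(z)=\sum_{k\in\mathbb{Z}}e^{\pi \mathbf{i}(k+\frac12)^2\tau+2\pi \mathbf{i}(k+\frac12)(z+\frac12)}$ divided by its derivative at $0$, so that $\theta'(0)=1$. Put $\widehat\theta(z)=\theta(z)\,e^{-2\pi(\mathrm{im}\,z)^2/\mathrm{im}\,\tau}$ and $\widehat\theta'=\partial_z\widehat\theta$. For $z\notin\Lambda$ let $\widehat{B}_m(z)$, $m\ge 0$, be the coefficients of the Laurent expansion in $c$ at $c=0$ $$e^{c\mathbf{A}(z)}\,\frac{\theta(z+c)}{\theta(z)\theta(c)}=\frac1c\sum_{m\ge0}\widehat{B}_m(z)\,\frac{c^m}{m!},\qquad \mathbf{A}(z)=-\frac{\pi}{\mathrm{im}\,\tau}(\bar z-z).$$ If $f$ is a function on $E$ that is smooth except for holomorphic poles (locally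 a smooth function divided by a power of $z-p$), its regularized integral is $\mathrm{reg}\!\int_E f\,\mathrm{vol}:=\int_E\alpha$, where $f\,\mathrm{vol}=\alpha+\partial\beta$, $\alpha$ is a $(1,1)$-form with at most logarithmic poles (locally a smooth form divided by $z-p$), and $\beta$ is a $(0,1)$-form that is smooth except for holomorphic poles. The value of $f$ at isolated points plays no role. For a function of $z_1,\dots,z_n$, the regularized integral over $E_{[n]}=E_n\times\cdots\times E_1$ is the iterated one, $\mathrm{reg}\!\int_{E_n}\mathrm{vol}_n\cdots\mathrm{reg}\!\int_{E_1}\mathrm{vol}_1$, the inner integrals being defined for almost all values of the remaining variables. Let $n\ge0$ and let $w_1,\dots,w_n\in\mathbb{C}$ be such that $\sum_{i\in S}w_i\notin\Lambda$ for every non-empty $S\subseteq[n]=\{1,\dots,n\}$. Let $\widehat Z_n$ be the $n\times n$ matrix with entries $\frac{\widehat\theta'}{\widehat\theta}(w_i+z_i-z_j)$, $1\le i,j\le n$. Then the regularized integral of $\det\widehat Z_n$ over $E_{[n]}$ exists, and $$\widehat G_{[n]}:=\mathrm{reg}\!\int_{E_{[n]}}\det(\widehat Z_n)\,\mathrm{vol}_1\cdots\mathrm{vol}_n=\sum_{\pi}\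 \prod_{S\in\pi}\frac{\widehat{B}_{|S|}\big(\sum_{i\in S}w_i\big)}{|S|},$$ where $\pi$ runs over all partitions of the set $[n]$ into non-empty blocks. (For $n=0$ both sides are $1$.) -/

import Mathlib

open scoped Topology ContDiff

noncomputable section

namespace EllipticCurveIntegral

/-- The operator `∂_z = (∂_x - i ∂_y) / 2`. -/
def dz (f : ℂ → ℂ) (z : ℂ) : ℂ :=
  (fderiv ℝ f z 1 - Complex.I * fderiv ℝ f z Complex.I) / 2

/-! ### Theta functions and Eisenstein-Kronecker functions -/

/-- The Jacobi theta function with characteristic `(1/2, 1/2)`,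
`∑ₙ exp (π i (n + 1/2)² τ + 2 π i (n + 1/2) (z + 1/2))`. -/
def oddTheta (τ : UpperHalfPlane) (z : ℂ) : ℂ :=
  ∑' n : ℤ, Complex.exp (Real.pi * Complex.I * ((n : ℂ) + 1 / 2) ^ 2 * (τ : ℂ) +
    2 * Real.pi * Complex.I * ((n : ℂ) + 1 / 2) * (z + 1 / 2))

/-- The odd theta function `θ`, normalized by `θ'(0) = 1`. -/
def theta (τ : UpperHalfPlane) (z : ℂ) : ℂ :=
  oddTheta τ z / deriv (oddTheta τ) 0

/-- `θ̂(z) = θ(z) exp (-2 π (im z)² / im τ)`. -/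
def thetaHat (τ : UpperHalfPlane) (z : ℂ) : ℂ :=
  theta τ z * Complex.exp (((-2 * Real.pi * z.im ^ 2 / τ.im : ℝ)) : ℂ)

/-- The quotient `θ̂' / θ̂`, where the prime is `∂_z`. -/
def dlogThetaHat (τ : UpperHalfPlane) (z : ℂ) : ℂ :=
  dz (thetaHat τ) z / thetaHat τ z

/-- `A(z) = -(π / im τ) (z̄ - z)`. -/
def anomaly (τ : UpperHalfPlane) (z : ℂ) : ℂ :=
  -((Real.pi / τ.im : ℝ) : ℂ) * (starRingEnd ℂ z - z)

/-- The completed Kronecker theta function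
`Ŝ_c(z) = exp (c A(z)) θ(z + c) / (θ(z) θ(c))`. -/
def kroneckerHat (τ : UpperHalfPlane) (c z : ℂ) : ℂ :=
  Complex.exp (c * anomaly τ z) * (theta τ (z + c) / (theta τ z * theta τ c))

/-- The function `c ↦ c Ŝ_c(z)`, with its removable singularity at `c = 0` removed. -/
def kroneckerHatRegular (τ : UpperHalfPlane) (z : ℂ) : ℂ → ℂ :=
  Function.update (fun c => c * kroneckerHat τ c z) 0
    (Filter.limUnder (𝓝[≠] (0 : ℂ)) (fun c => c * kroneckerHat τ c z))

/-- `B̂_m(z)`, given by the Laurent expansion `Ŝ_c(z) = (1 / c) ∑_{m ≥ 0} B̂_m(z) c^m / m!`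
at `c = 0`. -/
def BHat (τ : UpperHalfPlane) (m : ℕ) (z : ℂ) : ℂ :=
  iteratedDeriv m (kroneckerHatRegular τ z) 0

/-! ### Regularized integrals on `E = ℂ / (ℤ + ℤ τ)`

Functions on `E` are periodic functions on `ℂ`; what happens on a discrete set is ignored. -/

/-- Invariance under the lattice `ℤ + ℤ τ`. -/
def IsLatticePeriodic (τ : UpperHalfPlane) (f : ℂ → ℂ) : Prop :=
  ∀ z, f (z + 1) = f z ∧ f (z + (τ : ℂ)) = f z

/-- Near `p`, off `p` itself, `f` is a smooth (not necessarily holomorphic) function divided by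
`(z - p) ^ N`. -/
def HasHolomorphicPole (f : ℂ → ℂ) (N : ℕ) (p : ℂ) : Prop :=
  ∃ h : ℂ → ℂ, (∀ᶠ z in 𝓝 p, ContDiffAt ℝ ∞ h z) ∧ ∀ᶠ z in 𝓝[≠] p, f z = h z / (z - p) ^ N

/-- `∫_E f vol`, where `vol = (i / (2 im τ)) dz ∧ dz̄`; it is `ds ∧ dt` for `z = s + t τ`. -/
def torusIntegral (τ : UpperHalfPlane) (f : ℂ → ℂ) : ℂ :=
  ∫ p in Set.Ioc (0 : ℝ) 1 ×ˢ Set.Ioc (0 : ℝ) 1, f ((p.1 : ℂ) + (p.2 : ℂ) * (τ : ℂ))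

/-- `I` is a regularized integral of the form `f vol` on `E`: one can write `f vol = α + ∂β`
with `α = a vol` having at most logarithmic poles and `β = (i / (2 im τ)) b dz̄` smooth except for
holomorphic poles, so that `f = a + ∂_z b`, and `I = ∫_E α`. -/
def HasRegIntegral (τ : UpperHalfPlane) (f : ℂ → ℂ) (I : ℂ) : Prop :=
  ∃ a b : ℂ → ℂ, IsLatticePeriodic τ a ∧ IsLatticePeriodic τ b ∧
    (∀ p, HasHolomorphicPole a 1 p) ∧ (∀ p, ∃ N, HasHolomorphicPole b N p) ∧
    (∀ p, ∀ᶠ z in 𝓝[≠] p, f z = a z + dz b z) ∧ torusIntegral τ a = I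

/-- The form `f vol` has a regularized integral on `E`. -/
def RegIntegrable (τ : UpperHalfPlane) (f : ℂ → ℂ) : Prop :=
  ∃ I, HasRegIntegral τ f I

open Classical in
/-- The regularized integral of `f vol` over `E` (`0` if there is none). -/
def regIntegral (τ : UpperHalfPlane) (f : ℂ → ℂ) : ℂ :=
  if h : RegIntegrable τ f then h.choose else 0

/-- The iterated regularized integral of `F vol₁ ⋯ volₙ` over `Eₙ × ⋯ × E₁`, where the innermost
integration is over the first variable. -/
def iterRegIntegral (τ : UpperHalfPlane) : (n : ℕ) → ((Fin n → ℂ) → ℂ) → ℂ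
  | 0, F => F Fin.elim0
  | n + 1, F => iterRegIntegral τ n fun z => regIntegral τ fun z₁ => F (Fin.cons z₁ z)

/-- Every regularized integral in `iterRegIntegral` exists, for almost all values of the remaining
variables. -/
def IterRegIntegrable (τ : UpperHalfPlane) : (n : ℕ) → ((Fin n → ℂ) → ℂ) → Prop
  | 0, _ => True
  | n + 1, F =>
    (∀ᵐ z : Fin n → ℂ, RegIntegrable τ fun z₁ => F (Fin.cons z₁ z)) ∧
      IterRegIntegrable τ n fun z => regIntegral τ fun z₁ => F (Fin.cons z₁ z)

/-- The matrix `Ẑ_n`, with entries `(θ̂'/θ̂)(w_i + z_i - z_j)`. -/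
def ZHat (τ : UpperHalfPlane) {n : ℕ} (w z : Fin n → ℂ) : Matrix (Fin n) (Fin n) ℂ :=
  Matrix.of fun i j => dlogThetaHat τ (w i + z i - z j)

/-- `Ĝ_[n]`, the regularized integral of `det Ẑ_n · vol₁ ⋯ volₙ`. -/
def GHat (τ : UpperHalfPlane) {n : ℕ} (w : Fin n → ℂ) : ℂ :=
  iterRegIntegral τ n fun z => (ZHat τ w z).det

end EllipticCurveIntegral

end

/-!
Let `b_m = BHat τ m / m!` (`bCoeff`) be the Laurent coefficients of the Kronecker function and
`κ = π / im τ`. They are doubly periodic and smooth off the lattice, where `b_0 = 1` and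
`b_1 = dlogThetaHat`, and the factor `exp (c A(z))` of the Kronecker function gives
`∂̄ b_{m+1} = -κ b_m`. At the lattice points each `b_m` is a smooth function divided by `z`, whose
numerator vanishes at the pole unless `m = 1`, when it is `1`. All this rests on the fact that the
zeros of `theta` are simple and are exactly the lattice points. It is obtained by comparing `theta`
with the product `∏ (1 - qⁿ x) (1 - qⁿ⁺¹ x⁻¹)`, `x = exp (2 π i z)`: up to an exponential factor the
quotient is entire and doubly periodic, hence constant (`exp_mul_oddTheta_eq`).

**Regularized integrals.** They are unique: if a function with simple poles equals `∂b`, where `b` is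
smooth except for holomorphic poles, then `∂̄b` is bounded, so that Stokes' theorem on the torus
applies to `b` (`isBigO_of_euler`, `torusIntegral_dz_dzbar_eq_zero`,
`HasRegIntegral.eq_zero_of_zero`). For functions with simple poles they are ordinary integrals.

**Convolution.** If `x + y` is not a lattice point and `k, m ≥ 1`, then
`∫ b_k(x + z) b_m(y - z) vol = -b_{k+m}(x + y)` (`torusIntegral_bCoeff_mul`). Indeed
`∂̄ (b_{k+1}(x + z) b_{m+1}(y - z)) = κ (b_{k+1}(x + z) b_m(y - z) - b_k(x + z) b_{m+1}(y - z))`,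
and Stokes' theorem, applied after subtracting multiples of `b_1` to remove the residues, allows one
to move an index from one factor to the other. The residues contribute only when an index reaches
`0`, and this contribution is the right hand side.

**The determinant.** More generally, let `z_0` be integrated out of the determinant of the matrix with
entries `b_{m_i}(W_i + z_i - z_j)` (`bMatrix`). Expand along the row and the column of index `0`
(`det_eq_sub_sum_adjugate`). The diagonal entry contributes `b_{m_0}(W_0)` times the determinant in
the other variables. The product of an entry of the column and an entry of the row is integrated by
the convolution formula to `-b_{m_0 + m_i}(W_0 + W_i + z_i - z_j)`, so that the remaining terms add up
to determinants of the same kind, in which the pair `(m_0, W_0)` has been merged into `(m_i, W_i)`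
(`hasRegIntegral_det_bMatrix`). The sums of the `W_i` over non-empty subsets stay off the lattice.

**Partitions.** The value is therefore computed by a recursion (`mergeSum`) that splits off the first
pair or merges it into another one. The sum over the set partitions of the products of
`(|S| - 1)! b_{|S|}(∑_{i ∈ S} w_i)` satisfies the same recursion (`partitionSum_insert`), as
`(|S| - 1)!` is the number of cyclic orders of `S`, and an element of a cycle is either alone in it or
merged into its successor. Finally `(k - 1)! b_k = BHat τ k / k`.
-/

noncomputable section

namespace EllipticCurveIntegral

open Complex Filter Asymptotics MeasureTheory

/-! ### The lattice -/

/-- The lattice `ℤ + ℤ τ`. -/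
def lattice (τ : UpperHalfPlane) : AddSubgroup ℂ where
  carrier := {z | ∃ a b : ℤ, z = (a : ℂ) + (b : ℂ) * (τ : ℂ)}
  add_mem' := by
    rintro _ _ ⟨a, b, rfl⟩ ⟨c, d, rfl⟩
    exact ⟨a + c, b + d, by push_cast; ring⟩
  zero_mem' := ⟨0, 0, by simp⟩
  neg_mem' := by
    rintro _ ⟨a, b, rfl⟩
    exact ⟨-a, -b, by push_cast; ring⟩

lemma IsLatticePeriodic.add_mem {τ : UpperHalfPlane} {f : ℂ → ℂ} (hf : IsLatticePeriodic τ f)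
    {l : ℂ} (hl : l ∈ lattice τ) (z : ℂ) : f (z + l) = f z := by
  obtain ⟨a, b, rfl⟩ := hl
  have h1 : Function.Periodic f 1 := fun z => (hf z).1
  have h2 : Function.Periodic f (τ : ℂ) := fun z => (hf z).2
  rw [← add_assoc]
  have := (h2.int_mul b) (z + a)
  rw [this]
  simpa using h1.int_mul a z

/-- Every complex number is congruent modulo the lattice to a point of the closed fundamental
parallelogram. -/
lemma exists_lattice_reduction (τ : UpperHalfPlane) (z : ℂ) :
    ∃ l ∈ lattice τ, ∃ s ∈ Set.Icc (0 : ℝ) 1, ∃ t ∈ Set.Icc (0 : ℝ) 1,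
      z = (s : ℂ) + (t : ℂ) * (τ : ℂ) + l := by
  have hτ : τ.im ≠ 0 := τ.im_pos.ne'
  set t : ℝ := z.im / τ.im with ht
  set s : ℝ := z.re - t * τ.re with hs
  have hz : z = (s : ℂ) + (t : ℂ) * (τ : ℂ) := by
    apply Complex.ext
    · simp [hs]
    · simp [ht, hτ]
  refine ⟨(⌊s⌋ : ℂ) + (⌊t⌋ : ℂ) * (τ : ℂ), ⟨_, _, rfl⟩, Int.fract s, ?_, Int.fract t, ?_, ?_⟩
  · exact ⟨Int.fract_nonneg _, (Int.fract_lt_one _).le⟩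
  · exact ⟨Int.fract_nonneg _, (Int.fract_lt_one _).le⟩
  · rw [hz]
    simp only [Int.fract]
    push_cast
    ring

/-- The closed fundamental parallelogram is compact. -/
lemma isCompact_parallelogram (τ : UpperHalfPlane) :
    IsCompact ((fun p : ℝ × ℝ => (p.1 : ℂ) + (p.2 : ℂ) * (τ : ℂ)) ''
      (Set.Icc (0 : ℝ) 1 ×ˢ Set.Icc (0 : ℝ) 1)) :=
  (isCompact_Icc.prod isCompact_Icc).image (by fun_prop)

/-! ### Theta functions -/

lemma oddTheta_eq_jacobiTheta₂ (τ : UpperHalfPlane) (z : ℂ) :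
    oddTheta τ z = cexp (Real.pi * I * τ / 4 + Real.pi * I * (z + 1 / 2)) *
      jacobiTheta₂ (z + 1 / 2 + τ / 2) τ := by
  rw [oddTheta, jacobiTheta₂, ← tsum_mul_left]
  refine tsum_congr fun n => ?_
  rw [jacobiTheta₂_term, ← Complex.exp_add]
  congr 1
  ring

lemma differentiable_oddTheta (τ : UpperHalfPlane) : Differentiable ℂ (oddTheta τ) := by
  have h : oddTheta τ = fun z => cexp (Real.pi * I * τ / 4 + Real.pi * I * (z + 1 / 2)) *
      jacobiTheta₂ (z + 1 / 2 + τ / 2) τ := funext (oddTheta_eq_jacobiTheta₂ τ)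
  rw [h]
  intro z
  refine DifferentiableAt.mul (by fun_prop) ?_
  exact DifferentiableAt.comp (g := fun z => jacobiTheta₂ z τ) z
    (differentiableAt_jacobiTheta₂_fst _ τ.im_pos) (by fun_prop)

lemma oddTheta_add_one (τ : UpperHalfPlane) (z : ℂ) : oddTheta τ (z + 1) = -oddTheta τ z := by
  rw [oddTheta_eq_jacobiTheta₂, oddTheta_eq_jacobiTheta₂,
    show z + 1 + 1 / 2 + (τ : ℂ) / 2 = (z + 1 / 2 + τ / 2) + 1 by ring, jacobiTheta₂_add_left,
    show (Real.pi : ℂ) * I * τ / 4 + Real.pi * I * (z + 1 + 1 / 2)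
      = (Real.pi * I * τ / 4 + Real.pi * I * (z + 1 / 2)) + Real.pi * I by ring,
    Complex.exp_add, Complex.exp_pi_mul_I]
  ring

lemma oddTheta_add_tau (τ : UpperHalfPlane) (z : ℂ) :
    oddTheta τ (z + τ) = -cexp (-(Real.pi * I * τ) - 2 * Real.pi * I * z) * oddTheta τ z := by
  rw [oddTheta_eq_jacobiTheta₂, oddTheta_eq_jacobiTheta₂,
    show z + τ + 1 / 2 + (τ : ℂ) / 2 = (z + 1 / 2 + τ / 2) + τ by ring, jacobiTheta₂_add_left',
    ← Complex.exp_antiperiodic, ← mul_assoc, ← mul_assoc, ← Complex.exp_add, ← Complex.exp_add]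
  congr 1
  rw [Complex.exp_eq_exp_iff_exists_int]
  exact ⟨-1, by push_cast; ring⟩

lemma oddTheta_neg (τ : UpperHalfPlane) (z : ℂ) : oddTheta τ (-z) = -oddTheta τ z := by
  rw [oddTheta, oddTheta, ← tsum_neg, ← (Equiv.subLeft (-1 : ℤ)).tsum_eq]
  refine tsum_congr fun n => ?_
  rw [← Complex.exp_antiperiodic, Complex.exp_eq_exp_iff_exists_int]
  refine ⟨-n - 1, ?_⟩
  simp only [Equiv.subLeft_apply]
  push_cast
  ring

/-- The zeroth Fourier coefficient of the Jacobi theta function, which is therefore not identically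
zero. -/
lemma integral_jacobiTheta₂ (τ : UpperHalfPlane) :
    ∫ x in (0 : ℝ)..1, jacobiTheta₂ x τ = 1 := by
  have hs : Summable fun n : ℤ => Real.exp (-Real.pi * n ^ 2 * τ.im) := by
    have := (summable_jacobiTheta₂_term_iff 0 τ).2 τ.im_pos
    refine this.norm.congr fun n => ?_
    rw [norm_jacobiTheta₂_term]
    simp
  have h := intervalIntegral.hasSum_integral_of_dominated_convergence
    (μ := MeasureTheory.volume) (a := 0) (b := 1)
    (F := fun (n : ℤ) (x : ℝ) => jacobiTheta₂_term n x τ) (f := fun x : ℝ => jacobiTheta₂ x τ)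
    (fun n _ => Real.exp (-Real.pi * n ^ 2 * τ.im))
    (fun n => by
      apply Continuous.aestronglyMeasurable
      unfold jacobiTheta₂_term
      fun_prop)
    (fun n => by
      filter_upwards with x _
      rw [norm_jacobiTheta₂_term]
      simp)
    (by filter_upwards with x _ using hs)
    intervalIntegrable_const
    (by filter_upwards with x _ using hasSum_jacobiTheta₂_term x τ.im_pos)
  refine h.unique ?_
  have key : ∀ n : ℤ, ∫ x in (0 : ℝ)..1, jacobiTheta₂_term n x τ = if n = 0 then 1 else 0 := by
    intro n
    by_cases hn : n = 0
    · simp [hn, jacobiTheta₂_term]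
    · have hc : (2 * Real.pi * I * n : ℂ) ≠ 0 := by
        simp [Real.pi_ne_zero, hn]
      have e : ∀ x : ℝ, jacobiTheta₂_term n x τ =
          cexp (Real.pi * I * n ^ 2 * τ) * cexp (2 * Real.pi * I * n * x) := by
        intro x
        rw [jacobiTheta₂_term, ← Complex.exp_add, add_comm]
      simp only [e, hn, if_false]
      rw [intervalIntegral.integral_const_mul, integral_exp_mul_complex hc]
      have : cexp (2 * Real.pi * I * n * (1 : ℝ)) = 1 := by
        rw [Complex.exp_eq_one_iff]
        exact ⟨n, by push_cast; ring⟩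
      rw [this]
      simp
  simp only [key]
  exact hasSum_ite_eq 0 1

lemma exists_oddTheta_ne_zero (τ : UpperHalfPlane) : ∃ z, oddTheta τ z ≠ 0 := by
  by_contra! h
  have h0 : ∀ z, jacobiTheta₂ z τ = 0 := by
    intro z
    have := h (z - 1 / 2 - τ / 2)
    rw [oddTheta_eq_jacobiTheta₂, show z - 1 / 2 - (τ : ℂ) / 2 + 1 / 2 + τ / 2 = z by ring] at this
    simpa [Complex.exp_ne_zero] using this
  have := integral_jacobiTheta₂ τ
  simp [h0] at this

/-! ### The product expansion of the theta function -/

/-- The infinite product `∏_{n ≥ 0} (1 - qⁿ x)`. -/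
def qProd (q x : ℂ) : ℂ := ∏' n : ℕ, (1 + -(q ^ n * x))

lemma summable_qProd {q : ℂ} (hq : ‖q‖ < 1) (x : ℂ) :
    Summable fun n : ℕ => ‖-(q ^ n * x)‖ := by
  simpa using (summable_geometric_of_lt_one (norm_nonneg _) hq).mul_right ‖x‖

lemma differentiable_qProd {q : ℂ} (hq : ‖q‖ < 1) : Differentiable ℂ (qProd q) := by
  intro x
  have hx : x ∈ Metric.ball (0 : ℂ) (‖x‖ + 1) := by simp
  have h := Summable.hasProdLocallyUniformlyOn_nat_one_add
    (K := Metric.ball (0 : ℂ) (‖x‖ + 1)) (f := fun n y => -(q ^ n * y)) Metric.isOpen_ball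
    ((summable_geometric_of_lt_one (norm_nonneg _) hq).mul_right (‖x‖ + 1))
    (Eventually.of_forall fun n y hy => by
      rw [norm_neg, norm_mul, norm_pow]
      rw [mem_ball_zero_iff] at hy
      gcongr)
    (fun n => by fun_prop)
  refine (h.differentiableOn (.of_forall fun _ => ?_) Metric.isOpen_ball).differentiableAt
    (Metric.isOpen_ball.mem_nhds hx)
  simpa [Finset.prod_fn] using DifferentiableOn.finsetProd (fun _ _ => by fun_prop)

lemma qProd_eq_mul {q : ℂ} (hq : ‖q‖ < 1) (x : ℂ) : qProd q x = (1 - x) * qProd q (q * x) := by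
  have hm : Multipliable fun n : ℕ => 1 + -(q ^ n * x) :=
    multipliable_one_add_of_summable (summable_qProd hq x)
  have hm' : Multipliable fun n : ℕ => 1 + -(q ^ n * (q * x)) :=
    multipliable_one_add_of_summable (summable_qProd hq (q * x))
  rw [qProd, tprod_eq_zero_mul' (by simpa [pow_succ, mul_assoc] using hm'), qProd]
  congr 1
  · simp [sub_eq_add_neg]
  · simp only [pow_succ, mul_assoc]

lemma qProd_ne_zero {q : ℂ} (hq : ‖q‖ < 1) {x : ℂ} (hx : ∀ n : ℕ, q ^ n * x ≠ 1) :
    qProd q x ≠ 0 := by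
  refine tprod_one_add_ne_zero_of_summable (fun n h => hx n ?_) (summable_qProd hq x)
  linear_combination -h

/-- The nome `q = exp (2 π i τ)`. -/
def nome (τ : UpperHalfPlane) : ℂ := cexp (2 * Real.pi * I * τ)

lemma norm_nome_lt_one (τ : UpperHalfPlane) : ‖nome τ‖ < 1 := by
  rw [nome, Complex.norm_exp, Real.exp_lt_one_iff]
  have := mul_pos Real.pi_pos τ.im_pos
  simp
  linarith

/-- The theta product `∏_{n ≥ 0} (1 - qⁿ x) (1 - qⁿ⁺¹ x⁻¹)` with `x = exp (2 π i z)`. -/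
def thetaProd (τ : UpperHalfPlane) (z : ℂ) : ℂ :=
  qProd (nome τ) (cexp (2 * Real.pi * I * z)) * qProd (nome τ) (cexp (2 * Real.pi * I * (τ - z)))

/-- The theta product without its factor `1 - exp (2 π i z)`. -/
def thetaProdAux (τ : UpperHalfPlane) (z : ℂ) : ℂ :=
  qProd (nome τ) (cexp (2 * Real.pi * I * (τ + z))) *
    qProd (nome τ) (cexp (2 * Real.pi * I * (τ - z)))

lemma differentiable_thetaProd (τ : UpperHalfPlane) : Differentiable ℂ (thetaProd τ) := by
  have h := differentiable_qProd (norm_nome_lt_one τ)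
  unfold thetaProd
  fun_prop

lemma differentiable_thetaProdAux (τ : UpperHalfPlane) : Differentiable ℂ (thetaProdAux τ) := by
  have h := differentiable_qProd (norm_nome_lt_one τ)
  unfold thetaProdAux
  fun_prop

lemma qProd_cexp (τ : UpperHalfPlane) (z : ℂ) :
    qProd (nome τ) (cexp (2 * Real.pi * I * z)) =
      (1 - cexp (2 * Real.pi * I * z)) * qProd (nome τ) (cexp (2 * Real.pi * I * (τ + z))) := by
  rw [qProd_eq_mul (norm_nome_lt_one τ), nome, ← Complex.exp_add, mul_add]

lemma thetaProd_eq_mul (τ : UpperHalfPlane) (z : ℂ) :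
    thetaProd τ z = (1 - cexp (2 * Real.pi * I * z)) * thetaProdAux τ z := by
  rw [thetaProd, thetaProdAux, qProd_cexp, mul_assoc]

lemma nome_pow_mul_cexp (τ : UpperHalfPlane) (n : ℕ) (z : ℂ) :
    nome τ ^ n * cexp (2 * Real.pi * I * z) = cexp (2 * Real.pi * I * (n * τ + z)) := by
  rw [nome, ← Complex.exp_nat_mul, ← Complex.exp_add]
  ring_nf

lemma qProd_cexp_ne_zero {τ : UpperHalfPlane} {z : ℂ}
    (hz : ∀ (n : ℕ) (m : ℤ), n * (τ : ℂ) + z ≠ m) :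
    qProd (nome τ) (cexp (2 * Real.pi * I * z)) ≠ 0 := by
  refine qProd_ne_zero (norm_nome_lt_one τ) fun n h => ?_
  rw [nome_pow_mul_cexp, Complex.exp_eq_one_iff] at h
  obtain ⟨m, hm⟩ := h
  refine hz n m ?_
  have h2 : (2 * Real.pi * I : ℂ) ≠ 0 := Complex.two_pi_I_ne_zero
  apply mul_left_cancel₀ h2
  linear_combination hm

lemma thetaProd_ne_zero {τ : UpperHalfPlane} {z : ℂ} (hz : z ∉ lattice τ) :
    thetaProd τ z ≠ 0 := by
  refine mul_ne_zero (qProd_cexp_ne_zero fun n m h => hz ⟨m, -n, ?_⟩)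
    (qProd_cexp_ne_zero fun n m h => hz ⟨-m, n + 1, ?_⟩)
  · push_cast
    linear_combination h
  · push_cast
    linear_combination -h

lemma thetaProdAux_zero_ne_zero (τ : UpperHalfPlane) : thetaProdAux τ 0 ≠ 0 := by
  have h : ∀ (n : ℕ) (m : ℤ), n * (τ : ℂ) + τ ≠ m := by
    intro n m h
    have := congrArg Complex.im h
    simp at this
    have h2 := τ.im_pos
    have h3 : (0 : ℝ) ≤ n * τ.im := by positivity
    linarith
  refine mul_ne_zero ?_ ?_
  · simpa using qProd_cexp_ne_zero h
  · simpa using qProd_cexp_ne_zero h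

lemma thetaProd_add_one (τ : UpperHalfPlane) (z : ℂ) : thetaProd τ (z + 1) = thetaProd τ z := by
  have e1 : cexp (2 * Real.pi * I * (z + 1)) = cexp (2 * Real.pi * I * z) := by
    rw [Complex.exp_eq_exp_iff_exists_int]
    exact ⟨1, by push_cast; ring⟩
  have e2 : cexp (2 * Real.pi * I * (τ - (z + 1))) = cexp (2 * Real.pi * I * (τ - z)) := by
    rw [Complex.exp_eq_exp_iff_exists_int]
    exact ⟨-1, by push_cast; ring⟩
  rw [thetaProd, thetaProd, e1, e2]

lemma thetaProd_add_tau (τ : UpperHalfPlane) (z : ℂ) :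
    thetaProd τ (z + τ) = -cexp (-(2 * Real.pi * I * z)) * thetaProd τ z := by
  rw [thetaProd, thetaProd, qProd_cexp τ z, show (τ : ℂ) - (z + τ) = -z by ring, qProd_cexp τ (-z),
    add_comm z, show (τ : ℂ) + -z = τ - z by ring, mul_neg]
  have : cexp (-(2 * Real.pi * I * z)) * cexp (2 * Real.pi * I * z) = 1 := by
    rw [← Complex.exp_add]; simp
  linear_combination (-qProd (nome τ) (cexp (2 * Real.pi * I * (τ + z))) *
    qProd (nome τ) (cexp (2 * Real.pi * I * (τ - z)))) * this

lemma oddTheta_zero (τ : UpperHalfPlane) : oddTheta τ 0 = 0 := by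
  have := oddTheta_neg τ 0
  rw [neg_zero] at this
  exact self_eq_neg.1 this

/-- The quotient of `exp (π i z) oddTheta(z)` by the theta product is entire and doubly periodic,
hence constant; the constant is its value at `0`, a quotient of derivatives. -/
lemma exp_mul_oddTheta_eq (τ : UpperHalfPlane) : ∃ C : ℂ, C ≠ 0 ∧
    (deriv (oddTheta τ) 0 = C * (-(2 * Real.pi * I) * thetaProdAux τ 0)) ∧
    ∀ z, z ∉ lattice τ → cexp (Real.pi * I * z) * oddTheta τ z = C * thetaProd τ z := by
  classical
  set g : ℂ → ℂ := fun z => cexp (Real.pi * I * z) * oddTheta τ z with hg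
  have hgd : Differentiable ℂ g := by
    have := differentiable_oddTheta τ
    fun_prop
  set u : ℂ → ℂ := fun z => 1 - cexp (2 * Real.pi * I * z) with hu
  have hud : Differentiable ℂ u := by fun_prop
  have hu0 : u 0 = 0 := by simp [hu]
  have hg0 : g 0 = 0 := by simp [hg, oddTheta_zero]
  have hdu : deriv u 0 = -(2 * Real.pi * I) := by
    have : HasDerivAt u (-(cexp (2 * Real.pi * I * 0) * (2 * Real.pi * I * 1))) 0 :=
      (((hasDerivAt_id (0 : ℂ)).const_mul _).cexp).const_sub 1
    simpa using this.deriv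
  have hdg : deriv g 0 = deriv (oddTheta τ) 0 := by
    have h1 : HasDerivAt (fun z => cexp (Real.pi * I * z))
        (cexp (Real.pi * I * 0) * (Real.pi * I * 1)) 0 :=
      ((hasDerivAt_id (0 : ℂ)).const_mul _).cexp
    have := (h1.mul ((differentiable_oddTheta τ) 0).hasDerivAt).deriv
    simp only [oddTheta_zero] at this
    rw [hg]
    simpa using! this
  -- the quotient of the leading coefficients of `g` and of `thetaProd τ` at `0`
  set C : ℂ := dslope g 0 0 / (dslope u 0 0 * thetaProdAux τ 0) with hC
  have hden : dslope u 0 0 * thetaProdAux τ 0 ≠ 0 := by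
    rw [dslope_same, hdu]
    exact mul_ne_zero (neg_ne_zero.2 Complex.two_pi_I_ne_zero) (thetaProdAux_zero_ne_zero τ)
  set R : ℂ → ℂ := fun z => if z ∈ lattice τ then C else g z / thetaProd τ z with hR
  have hgone : ∀ z, g (z + 1) = g z := by
    intro z
    simp only [hg, oddTheta_add_one, mul_add, mul_one, Complex.exp_add, Complex.exp_pi_mul_I]
    ring
  have hgtau : ∀ z, g (z + τ) = -cexp (-(2 * Real.pi * I * z)) * g z := by
    intro z
    simp only [hg, oddTheta_add_tau]
    have : cexp (Real.pi * I * (z + τ)) * cexp (-(Real.pi * I * τ) - 2 * Real.pi * I * z) =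
        cexp (-(2 * Real.pi * I * z)) * cexp (Real.pi * I * z) := by
      rw [← Complex.exp_add, ← Complex.exp_add]
      ring_nf
    linear_combination (-oddTheta τ z) * this
  have hone : (1 : ℂ) ∈ lattice τ := ⟨1, 0, by simp⟩
  have htau : (τ : ℂ) ∈ lattice τ := ⟨0, 1, by simp⟩
  have hRp : IsLatticePeriodic τ R := by
    intro z
    constructor
    · simp only [hR, AddSubgroup.add_mem_cancel_right _ hone, hgone, thetaProd_add_one]
    · simp only [hR, AddSubgroup.add_mem_cancel_right _ htau, hgtau, thetaProd_add_tau]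
      rw [mul_div_mul_left _ _ (neg_ne_zero.2 (Complex.exp_ne_zero _))]
  have hzero : ∀ z ∈ lattice τ, thetaProd τ z = 0 := by
    intro z hz
    by_contra h
    obtain ⟨a, b, rfl⟩ := hz
    have h1 : ∀ a : ℤ, thetaProd τ ((a : ℂ) + (b : ℂ) * (τ : ℂ)) = thetaProd τ (b * (τ : ℂ)) := by
      intro a
      have : Function.Periodic (thetaProd τ) 1 := thetaProd_add_one τ
      simpa [add_comm] using this.int_mul a (b * (τ : ℂ))
    rw [h1] at h
    have h2 : ∀ b : ℤ, thetaProd τ (b * (τ : ℂ)) = 0 := by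
      intro b
      induction b using Int.induction_on with
      | zero => simp [thetaProd_eq_mul]
      | succ n ih =>
        have := thetaProd_add_tau τ (((n : ℤ) : ℂ) * τ)
        rw [ih, mul_zero] at this
        rw [← this]; push_cast; ring_nf
      | pred n ih =>
        have := thetaProd_add_tau τ (((-n - 1 : ℤ) : ℂ) * τ)
        rw [show ((-n - 1 : ℤ) : ℂ) * (τ : ℂ) + τ = ((-n : ℤ) : ℂ) * τ by push_cast; ring, ih] at this
        simpa [Complex.exp_ne_zero] using this.symm
    exact h (h2 b)
  -- at `0` numerator and denominator have simple zeros, which are cancelled by `dslope`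
  have hRd0 : DifferentiableAt ℂ R 0 := by
    have hd : DifferentiableAt ℂ (fun z => dslope g 0 z / (dslope u 0 z * thetaProdAux τ z)) 0 := by
      have h1 : DifferentiableAt ℂ (dslope g 0) 0 :=
        ((Complex.differentiableOn_dslope (Filter.univ_mem)).2 hgd.differentiableOn).differentiableAt
          Filter.univ_mem
      have h2 : DifferentiableAt ℂ (dslope u 0) 0 :=
        ((Complex.differentiableOn_dslope (Filter.univ_mem)).2 hud.differentiableOn).differentiableAt
          Filter.univ_mem
      exact h1.div (h2.mul (differentiable_thetaProdAux τ 0)) hden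
    refine hd.congr_of_eventuallyEq ?_
    have hc : ContinuousAt (fun z => dslope u 0 z * thetaProdAux τ z) 0 :=
      (continuousAt_dslope_same.2 (hud 0)).mul (differentiable_thetaProdAux τ 0).continuousAt
    filter_upwards [hc.eventually_ne hden] with z hz
    by_cases hz0 : z = 0
    · subst hz0
      simp [hR, hC, (lattice τ).zero_mem]
    · have hp : thetaProd τ z = z * (dslope u 0 z * thetaProdAux τ z) := by
        rw [thetaProd_eq_mul, dslope_of_ne _ hz0, slope_def_field, hu0]
        field_simp
        simp only [hu, sub_zero]
        ring
      have hgz : g z = z * dslope g 0 z := by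
        rw [dslope_of_ne _ hz0, slope_def_field, hg0]
        field_simp
        simp [mul_comm]
      have hzl : z ∉ lattice τ := by
        intro h
        have := hzero z h
        rw [hp] at this
        exact mul_ne_zero hz0 hz this
      simp only [hR, if_neg hzl, hp, hgz]
      rw [mul_div_mul_left _ _ hz0]
  have hRd : Differentiable ℂ R := by
    intro z
    by_cases hz : z ∈ lattice τ
    · have e : R = fun y => R (y - z) := by
        funext y
        rw [← hRp.add_mem hz (y - z), sub_add_cancel]
      rw [e]
      have h0 : DifferentiableAt ℂ R (z - z) := by rwa [sub_self]
      exact DifferentiableAt.comp (g := R) z h0 (by fun_prop)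
    · have hne := thetaProd_ne_zero hz
      refine ((hgd z).div (differentiable_thetaProd τ z) hne).congr_of_eventuallyEq ?_
      filter_upwards [(differentiable_thetaProd τ z).continuousAt.eventually_ne hne] with y hy
      have hyl : y ∉ lattice τ := fun h => hy (hzero y h)
      simp [hR, hyl]
  -- Liouville's theorem applies, as `R` takes all its values on the compact parallelogram
  have hRb : Bornology.IsBounded (Set.range R) := by
    refine ((isCompact_parallelogram τ).image hRd.continuous).isBounded.subset ?_
    rintro _ ⟨z, rfl⟩
    obtain ⟨l, hl, s, hs, t, ht, rfl⟩ := exists_lattice_reduction τ z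
    rw [hRp.add_mem hl]
    exact ⟨_, ⟨(s, t), ⟨hs, ht⟩, rfl⟩, rfl⟩
  have hconst : ∀ z, R z = C := by
    intro z
    rw [hRd.apply_eq_apply_of_bounded hRb z 0]
    simp [hR, (lattice τ).zero_mem]
  have hmain : ∀ z, z ∉ lattice τ → g z = C * thetaProd τ z := by
    intro z hz
    have := hconst z
    simp only [hR, if_neg hz] at this
    rw [← this, div_mul_cancel₀ _ (thetaProd_ne_zero hz)]
  refine ⟨C, ?_, ?_, hmain⟩
  -- if `C = 0`, the theta function vanishes off the lattice, which leads to a contradiction at a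
  -- point where it does not vanish
  · intro hC0
    have hz : ∀ z, z ∉ lattice τ → oddTheta τ z = 0 := by
      intro z hz
      have := hmain z hz
      rw [hC0, zero_mul] at this
      simpa [hg, Complex.exp_ne_zero] using this
    obtain ⟨z, hz'⟩ := exists_oddTheta_ne_zero τ
    have hev : ∀ᶠ y in 𝓝 z, oddTheta τ y ≠ 0 :=
      (differentiable_oddTheta τ z).continuousAt.eventually_ne hz'
    have hlat : ∀ᶠ y in 𝓝 z, y ∈ lattice τ := by
      filter_upwards [hev] with y hy
      by_contra h
      exact hy (hz y h)
    have hfreq : ∃ᶠ y in 𝓝[≠] z, thetaProd τ y = 0 :=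
      ((hlat.filter_mono nhdsWithin_le_nhds).mono fun y hy => hzero y hy).frequently
    have hzero' := ((differentiable_thetaProd τ).differentiableOn.analyticOnNhd
      isOpen_univ).eqOn_zero_of_preconnected_of_frequently_eq_zero isPreconnected_univ
      (Set.mem_univ z) hfreq
    obtain ⟨y, hy⟩ : ∃ y : ℂ, y ∉ lattice τ := by
      refine ⟨1 / 2, ?_⟩
      rintro ⟨a, b, h⟩
      have him := congrArg Complex.im h
      have hre := congrArg Complex.re h
      simp [τ.im_pos.ne'] at him
      simp [him] at hre
      have : (2 * a : ℝ) = 1 := by rw [← hre]; norm_num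
      have h' : (2 * a : ℤ) = 1 := by exact_mod_cast this
      omega
    exact thetaProd_ne_zero hy (hzero' (Set.mem_univ y))
  · rw [← hdg, ← hdu, ← dslope_same, ← dslope_same, hC, div_mul_cancel₀ _ hden]

lemma oddTheta_ne_zero {τ : UpperHalfPlane} {z : ℂ} (hz : z ∉ lattice τ) : oddTheta τ z ≠ 0 := by
  obtain ⟨C, hC, -, h⟩ := exp_mul_oddTheta_eq τ
  intro h0
  have := h z hz
  rw [h0, mul_zero] at this
  exact mul_ne_zero hC (thetaProd_ne_zero hz) this.symm

lemma deriv_oddTheta_zero_ne_zero (τ : UpperHalfPlane) : deriv (oddTheta τ) 0 ≠ 0 := by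
  obtain ⟨C, hC, h, -⟩ := exp_mul_oddTheta_eq τ
  rw [h]
  exact mul_ne_zero hC (mul_ne_zero (neg_ne_zero.2 Complex.two_pi_I_ne_zero)
    (thetaProdAux_zero_ne_zero τ))

lemma differentiable_theta (τ : UpperHalfPlane) : Differentiable ℂ (theta τ) := by
  have := differentiable_oddTheta τ
  unfold theta
  fun_prop

lemma theta_ne_zero {τ : UpperHalfPlane} {z : ℂ} (hz : z ∉ lattice τ) : theta τ z ≠ 0 :=
  div_ne_zero (oddTheta_ne_zero hz) (deriv_oddTheta_zero_ne_zero τ)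

lemma theta_neg (τ : UpperHalfPlane) (z : ℂ) : theta τ (-z) = -theta τ z := by
  rw [theta, theta, oddTheta_neg, neg_div]

lemma theta_zero (τ : UpperHalfPlane) : theta τ 0 = 0 := by
  rw [theta, oddTheta_zero, zero_div]

lemma deriv_theta_zero (τ : UpperHalfPlane) : deriv (theta τ) 0 = 1 := by
  unfold theta
  rw [deriv_div_const, div_self (deriv_oddTheta_zero_ne_zero τ)]

lemma theta_add_one (τ : UpperHalfPlane) (z : ℂ) : theta τ (z + 1) = -theta τ z := by
  rw [theta, theta, oddTheta_add_one, neg_div]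

lemma theta_add_tau (τ : UpperHalfPlane) (z : ℂ) :
    theta τ (z + τ) = -cexp (-(Real.pi * I * τ) - 2 * Real.pi * I * z) * theta τ z := by
  rw [theta, theta, oddTheta_add_tau, mul_div_assoc]

/-! ### The operators `∂_z` and `∂_z̄` -/

/-- The operator `∂_z̄ = (∂_x + i ∂_y) / 2`. -/
def dzbar (f : ℂ → ℂ) (z : ℂ) : ℂ :=
  (fderiv ℝ f z 1 + I * fderiv ℝ f z I) / 2

lemma fderiv_apply_eq (f : ℂ → ℂ) (z v : ℂ) :
    fderiv ℝ f z v = v * dz f z + starRingEnd ℂ v * dzbar f z := by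
  have hv : v = v.re • (1 : ℂ) + v.im • I := by
    apply Complex.ext <;> simp
  have h1 : fderiv ℝ f z v = v.re * fderiv ℝ f z 1 + v.im * fderiv ℝ f z I := by
    conv_lhs => rw [hv]
    rw [map_add, map_smul, map_smul]
    simp
  have h2 : v = v.re + v.im * I := (re_add_im v).symm
  have h3 : starRingEnd ℂ v = v.re - v.im * I := by
    apply Complex.ext <;> simp
  rw [h1, h3, dz, dzbar]
  conv_rhs => rw [show v * ((fderiv ℝ f z 1 - I * fderiv ℝ f z I) / 2) =
    (v.re + v.im * I) * ((fderiv ℝ f z 1 - I * fderiv ℝ f z I) / 2) by rw [← h2]]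
  linear_combination ((v.im : ℂ) * fderiv ℝ f z I) * I_sq

lemma norm_fderiv_le (f : ℂ → ℂ) (z : ℂ) : ‖fderiv ℝ f z‖ ≤ ‖dz f z‖ + ‖dzbar f z‖ := by
  refine ContinuousLinearMap.opNorm_le_bound _ (by positivity) fun v => ?_
  rw [fderiv_apply_eq]
  refine (norm_add_le _ _).trans ?_
  rw [norm_mul, norm_mul, RCLike.norm_conj]
  linarith

section Rules

variable {f g : ℂ → ℂ} {z : ℂ}

lemma _root_.Filter.EventuallyEq.dz_eq (h : f =ᶠ[𝓝 z] g) : dz f z = dz g z := by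
  rw [dz, dz, h.fderiv_eq]

lemma _root_.Filter.EventuallyEq.dzbar_eq (h : f =ᶠ[𝓝 z] g) : dzbar f z = dzbar g z := by
  rw [dzbar, dzbar, h.fderiv_eq]

lemma dz_add (hf : DifferentiableAt ℝ f z) (hg : DifferentiableAt ℝ g z) :
    dz (fun z => f z + g z) z = dz f z + dz g z := by
  simp only [dz, fderiv_fun_add hf hg, add_apply]; ring

lemma dzbar_add (hf : DifferentiableAt ℝ f z) (hg : DifferentiableAt ℝ g z) :
    dzbar (fun z => f z + g z) z = dzbar f z + dzbar g z := by
  simp only [dzbar, fderiv_fun_add hf hg, add_apply]; ring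

lemma dz_sub (hf : DifferentiableAt ℝ f z) (hg : DifferentiableAt ℝ g z) :
    dz (fun z => f z - g z) z = dz f z - dz g z := by
  simp only [dz, fderiv_fun_sub hf hg, sub_apply]; ring

lemma dzbar_sub (hf : DifferentiableAt ℝ f z) (hg : DifferentiableAt ℝ g z) :
    dzbar (fun z => f z - g z) z = dzbar f z - dzbar g z := by
  simp only [dzbar, fderiv_fun_sub hf hg, sub_apply]; ring

lemma dz_mul (hf : DifferentiableAt ℝ f z) (hg : DifferentiableAt ℝ g z) :
    dz (fun z => f z * g z) z = dz f z * g z + f z * dz g z := by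
  simp only [dz, fderiv_fun_mul hf hg, add_apply,
    smul_apply, smul_eq_mul]; ring

lemma dzbar_mul (hf : DifferentiableAt ℝ f z) (hg : DifferentiableAt ℝ g z) :
    dzbar (fun z => f z * g z) z = dzbar f z * g z + f z * dzbar g z := by
  simp only [dzbar, fderiv_fun_mul hf hg, add_apply,
    smul_apply, smul_eq_mul]; ring

lemma dz_const_mul (c : ℂ) (hf : DifferentiableAt ℝ f z) :
    dz (fun z => c * f z) z = c * dz f z := by
  simp only [dz, fderiv_const_mul hf, smul_apply, smul_eq_mul]; ring

lemma dzbar_const_mul (c : ℂ) (hf : DifferentiableAt ℝ f z) :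
    dzbar (fun z => c * f z) z = c * dzbar f z := by
  simp only [dzbar, fderiv_const_mul hf, smul_apply, smul_eq_mul]; ring

lemma dz_eq_deriv (hf : DifferentiableAt ℂ f z) : dz f z = deriv f z := by
  have h := hf.hasDerivAt.hasFDerivAt.restrictScalars ℝ
  simp only [dz, h.fderiv]
  simp
  linear_combination (-deriv f z / 2) * I_sq

lemma dzbar_eq_zero (hf : DifferentiableAt ℂ f z) : dzbar f z = 0 := by
  have h := hf.hasDerivAt.hasFDerivAt.restrictScalars ℝ
  simp only [dzbar, h.fderiv]
  simp
  linear_combination (deriv f z) * I_sq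

lemma contDiffAt_dz (hf : ContDiffAt ℝ ∞ f z) : ContDiffAt ℝ ∞ (dz f) z := by
  have h : ContDiffAt ℝ ∞ (fderiv ℝ f) z := hf.fderiv_right (m := ∞) (by simp)
  unfold dz
  fun_prop

lemma contDiffAt_dzbar (hf : ContDiffAt ℝ ∞ f z) : ContDiffAt ℝ ∞ (dzbar f) z := by
  have h : ContDiffAt ℝ ∞ (fderiv ℝ f) z := hf.fderiv_right (m := ∞) (by simp)
  unfold dzbar
  fun_prop

lemma dz_dzbar_comm (hf : ContDiffAt ℝ ∞ f z) : dzbar (dz f) z = dz (dzbar f) z := by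
  have h : ContDiffAt ℝ ∞ (fderiv ℝ f) z := hf.fderiv_right (m := ∞) (by simp)
  have hd : DifferentiableAt ℝ (fderiv ℝ f) z := h.differentiableAt (by simp)
  have hs : IsSymmSndFDerivAt ℝ f z := hf.isSymmSndFDerivAt (by
    rw [minSmoothness_of_isRCLikeNormedField]
    exact WithTop.coe_le_coe.2 le_top)
  have e : ∀ v w : ℂ, fderiv ℝ (fun y => fderiv ℝ f y v) z w = fderiv ℝ (fderiv ℝ f) z w v := by
    intro v w
    have := hd.hasFDerivAt.clm_apply (hasFDerivAt_const v z)
    rw [this.fderiv]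
    simp
  have d : ∀ v : ℂ, DifferentiableAt ℝ (fun y => fderiv ℝ f y v) z := fun v => by fun_prop
  have e1 : ∀ w, fderiv ℝ (dz f) z w =
      (fderiv ℝ (fderiv ℝ f) z w 1 - I * fderiv ℝ (fderiv ℝ f) z w I) / 2 := by
    intro w
    have := ((d 1).hasFDerivAt.sub ((d I).hasFDerivAt.const_mul I)).mul_const (1 / 2 : ℂ)
    have h2 : dz f = fun y => (fderiv ℝ f y 1 - I * fderiv ℝ f y I) * (1 / 2) := by
      funext y; rw [dz]; ring
    rw [h2]
    erw [this.fderiv]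
    simp [e]
    ring
  have e2 : ∀ w, fderiv ℝ (dzbar f) z w =
      (fderiv ℝ (fderiv ℝ f) z w 1 + I * fderiv ℝ (fderiv ℝ f) z w I) / 2 := by
    intro w
    have := ((d 1).hasFDerivAt.add ((d I).hasFDerivAt.const_mul I)).mul_const (1 / 2 : ℂ)
    have h2 : dzbar f = fun y => (fderiv ℝ f y 1 + I * fderiv ℝ f y I) * (1 / 2) := by
      funext y; rw [dzbar]; ring
    rw [h2]
    erw [this.fderiv]
    simp [e]
    ring
  rw [dzbar, dz]
  simp only [e1, e2]
  rw [hs 1 I]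
  ring

end Rules

/-! ### A regularity lemma for the Euler operator -/

lemma isBigO_pow_succ_of_fderiv {h : ℂ → ℂ} {p : ℂ} {k : ℕ}
    (hd : ∀ᶠ z in 𝓝 p, DifferentiableAt ℝ h z) (h0 : h p = 0)
    (h1 : dz h =O[𝓝 p] fun z => (z - p) ^ k) (h2 : dzbar h =O[𝓝 p] fun z => (z - p) ^ k) :
    h =O[𝓝 p] fun z => (z - p) ^ (k + 1) := by
  obtain ⟨C₁, hC₁, hb₁⟩ := h1.exists_pos
  obtain ⟨C₂, hC₂, hb₂⟩ := h2.exists_pos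
  obtain ⟨r, hr, hball⟩ := Metric.eventually_nhds_iff_ball.1 (hd.and (hb₁.bound.and hb₂.bound))
  refine IsBigO.of_bound (C₁ + C₂) ?_
  filter_upwards [Metric.ball_mem_nhds p hr] with z hz
  have hb : ∀ y ∈ Metric.closedBall p ‖z - p‖, ‖fderiv ℝ h y‖ ≤ (C₁ + C₂) * ‖z - p‖ ^ k := by
    intro y hy
    have hy' : ‖y - p‖ ≤ ‖z - p‖ := by simpa [dist_eq_norm] using hy
    have hyr : y ∈ Metric.ball p r := by
      rw [mem_ball_iff_norm] at hz ⊢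
      exact hy'.trans_lt hz
    obtain ⟨-, b1, b2⟩ := hball y hyr
    rw [norm_pow] at b1 b2
    have b3 : ‖fderiv ℝ h y‖ ≤ (C₁ + C₂) * ‖y - p‖ ^ k := by
      linarith [norm_fderiv_le h y]
    exact b3.trans (by gcongr)
  have := (convex_closedBall p ‖z - p‖).norm_image_sub_le_of_norm_fderiv_le (𝕜 := ℝ) (f := h)
    (fun y hy => (hball y (by
      rw [mem_closedBall_iff_norm] at hy
      rw [mem_ball_iff_norm] at hz ⊢
      exact hy.trans_lt hz)).1) hb (Metric.mem_closedBall_self (norm_nonneg _))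
    (y := z) (by simp [dist_eq_norm])
  rw [h0, sub_zero] at this
  rw [norm_pow, pow_succ]
  linarith

/-- If `h` and `g` are smooth near `p` and `(z - p) ∂h - N h = (z - p) ^ N g`, then no monomial
`(z - p)ⁱ (z̄ - p̄)ʲ` with `i < N` occurs in the Taylor expansion of `h` at `p`, because the Euler
operator multiplies it by `i - N ≠ 0`. In particular `h` vanishes to order `N`. The induction
is possible because `∂h` and `∂̄h` satisfy equations of the same kind. -/
lemma isBigO_of_euler {p : ℂ} (k : ℕ) : ∀ N, k ≤ N → ∀ h g : ℂ → ℂ,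
    (∀ᶠ z in 𝓝 p, ContDiffAt ℝ ∞ h z) → (∀ᶠ z in 𝓝 p, ContDiffAt ℝ ∞ g z) →
    (∀ᶠ z in 𝓝 p, (z - p) * dz h z - N * h z = (z - p) ^ N * g z) →
    (h =O[𝓝 p] fun z => (z - p) ^ k) ∧ (dzbar h =O[𝓝 p] fun z => (z - p) ^ k) := by
  -- the equation is inherited by `∂̄h`
  have hbar : ∀ N : ℕ, ∀ h g : ℂ → ℂ,
      (∀ᶠ z in 𝓝 p, ContDiffAt ℝ ∞ h z) → (∀ᶠ z in 𝓝 p, ContDiffAt ℝ ∞ g z) →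
      (∀ᶠ z in 𝓝 p, (z - p) * dz h z - N * h z = (z - p) ^ N * g z) →
      ∀ᶠ z in 𝓝 p, (z - p) * dz (dzbar h) z - N * dzbar h z = (z - p) ^ N * dzbar g z := by
    intro N h g hh hg he
    filter_upwards [he.eventually_nhds, hh, hg] with z hz hhz hgz
    have e := Filter.EventuallyEq.dzbar_eq (f := fun z => (z - p) * dz h z - N * h z) hz
    have d1 : DifferentiableAt ℝ h z := hhz.differentiableAt (by simp)
    have d2 : DifferentiableAt ℝ (dz h) z := (contDiffAt_dz hhz).differentiableAt (by simp)
    have d3 : DifferentiableAt ℝ g z := hgz.differentiableAt (by simp)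
    rw [dzbar_sub (by fun_prop) (by fun_prop), dzbar_mul (by fun_prop) d2, dzbar_const_mul _ d1,
      dzbar_mul (by fun_prop) d3, dzbar_eq_zero (f := fun z => z - p) (by fun_prop),
      dzbar_eq_zero (f := fun z => (z - p) ^ N) (by fun_prop), dz_dzbar_comm hhz] at e
    linear_combination e
  suffices H : ∀ N, k ≤ N → ∀ h g : ℂ → ℂ,
      (∀ᶠ z in 𝓝 p, ContDiffAt ℝ ∞ h z) → (∀ᶠ z in 𝓝 p, ContDiffAt ℝ ∞ g z) →
      (∀ᶠ z in 𝓝 p, (z - p) * dz h z - N * h z = (z - p) ^ N * g z) →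
      h =O[𝓝 p] fun z => (z - p) ^ k by
    intro N hN h g hh hg he
    exact ⟨H N hN h g hh hg he, H N hN _ _ (hh.mono fun z => contDiffAt_dzbar)
      (hg.mono fun z => contDiffAt_dzbar) (hbar N h g hh hg he)⟩
  induction k with
  | zero =>
    intro N _ h g hh _ _
    simpa using hh.self_of_nhds.continuousAt.isBigO_one ℂ
  | succ k ih =>
    intro N hN h g hh hg he
    obtain ⟨M, rfl⟩ : ∃ M, N = M + 1 := ⟨N - 1, by omega⟩
    have h0 : h p = 0 := by
      have := he.self_of_nhds
      simp only [sub_self, zero_mul, zero_sub, ne_eq, Nat.succ_ne_zero, not_false_eq_true,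
        zero_pow, neg_eq_zero, mul_eq_zero] at this
      exact this.resolve_left (by exact_mod_cast Nat.succ_ne_zero M)
    refine isBigO_pow_succ_of_fderiv (hh.mono fun z hz => hz.differentiableAt (by simp)) h0 ?_ ?_
    · refine ih M (by omega) (dz h) (fun z => (M + 1 : ℕ) * g z + (z - p) * dz g z)
        (hh.mono fun z => contDiffAt_dz) ?_ ?_
      · filter_upwards [hg] with z hz
        have := contDiffAt_dz hz
        fun_prop
      · filter_upwards [he.eventually_nhds, hh, hg] with z hz hhz hgz
        have e := Filter.EventuallyEq.dz_eq
          (f := fun z => (z - p) * dz h z - (M + 1 : ℕ) * h z) hz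
        have d1 : DifferentiableAt ℝ h z := hhz.differentiableAt (by simp)
        have d2 : DifferentiableAt ℝ (dz h) z := (contDiffAt_dz hhz).differentiableAt (by simp)
        have d3 : DifferentiableAt ℝ g z := hgz.differentiableAt (by simp)
        have p1 : dz (fun z => z - p) z = 1 := by
          rw [dz_eq_deriv (by fun_prop)]
          simp
        have p2 : dz (fun z => (z - p) ^ (M + 1)) z = (M + 1) * (z - p) ^ M := by
          rw [dz_eq_deriv (by fun_prop), deriv_fun_pow (by fun_prop)]
          simp
        rw [dz_sub (by fun_prop) (by fun_prop), dz_mul (by fun_prop) d2, dz_const_mul _ d1,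
          dz_mul (by fun_prop) d3, p1, p2] at e
        push_cast at e ⊢
        linear_combination e
    · exact ih (M + 1) (by omega) (dzbar h) (dzbar g) (hh.mono fun z => contDiffAt_dzbar)
        (hg.mono fun z => contDiffAt_dzbar) (hbar _ h g hh hg he)

/-! ### Integrability of functions with simple poles -/

lemma integrableOn_ball_inv_norm {E : Type*} [NormedAddCommGroup E] [NormedSpace ℝ E]
    [MeasurableSpace E] [BorelSpace E] [FiniteDimensional ℝ E] (μ : Measure E)
    [μ.IsAddHaarMeasure] (hE : Module.finrank ℝ E = 2) (r : ℝ) (p : E) :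
    IntegrableOn (fun x => ‖x - p‖⁻¹) (Metric.ball p r) μ := by
  have : Nontrivial E := Module.nontrivial_of_finrank_pos (R := ℝ) (by omega)
  have h0 : IntegrableOn (fun x : E => ‖x‖⁻¹) (Metric.ball 0 r) μ := by
    rw [integrableOn_fun_norm_addHaar μ (f := fun y => y⁻¹), hE]
    refine (integrableOn_const (C := (1 : ℝ)) (by simp)).congr_fun (fun y hy => ?_)
      measurableSet_Ioo
    have : y ≠ 0 := hy.1.ne'
    simp [this]
  have hm := measurePreserving_sub_right μ p
  have := (hm.integrableOn_comp_preimage (MeasurableEquiv.subRight p).measurableEmbedding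
    (f := fun x : E => ‖x‖⁻¹) (s := Metric.ball 0 r)).2 h0
  have hset : (fun x => x - p) ⁻¹' Metric.ball 0 r = Metric.ball p r := by
    ext x
    simp [dist_eq_norm]
  rw [hset] at this
  exact this

lemma locallyIntegrable_of_isBigO_inv {E : Type*} [NormedAddCommGroup E] [NormedSpace ℝ E]
    [MeasurableSpace E] [BorelSpace E] [FiniteDimensional ℝ E] (μ : Measure E)
    [μ.IsAddHaarMeasure] (hE : Module.finrank ℝ E = 2) {F : E → ℂ}
    (hc : ∀ p, ∀ᶠ x in 𝓝[≠] p, ContinuousAt F x)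
    (hO : ∀ p, F =O[𝓝[≠] p] fun x => ‖x - p‖⁻¹) : LocallyIntegrable F μ := by
  have : Nontrivial E := Module.nontrivial_of_finrank_pos (R := ℝ) (by omega)
  intro p
  obtain ⟨C, hC⟩ := (hO p).bound
  have hboth := eventually_nhdsWithin_iff.1 ((hc p).and hC)
  obtain ⟨r, hr, hball⟩ := Metric.eventually_nhds_iff_ball.1 hboth
  refine ⟨Metric.ball p r, Metric.ball_mem_nhds p hr, ?_⟩
  have hint : IntegrableOn (fun x => C * ‖x - p‖⁻¹) (Metric.ball p r \ {p}) μ :=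
    ((integrableOn_ball_inv_norm μ hE r p).mono_set Set.sdiff_subset).const_mul C
  have hmeas : MeasurableSet (Metric.ball p r \ {p}) :=
    Metric.isOpen_ball.measurableSet.diff (measurableSet_singleton p)
  have h1 : IntegrableOn F (Metric.ball p r \ {p}) μ := by
    refine hint.mono' ?_ ?_
    · refine ContinuousOn.aestronglyMeasurable (fun x hx => ?_) hmeas
      exact (hball x hx.1 hx.2).1.continuousWithinAt
    · refine (ae_restrict_iff' hmeas).2 (Eventually.of_forall fun x hx => ?_)
      simpa using (hball x hx.1 hx.2).2
  have h2 : IntegrableOn F {p} μ := by simp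
  exact (h1.union h2).mono_set fun x hx => by
    by_cases hxp : x = p
    · exact Or.inr hxp
    · exact Or.inl ⟨hx, hxp⟩

/-- The coordinates `(s, t) ↦ s + t τ`. -/
def torusCoord (τ : UpperHalfPlane) : (ℝ × ℝ) ≃L[ℝ] ℂ :=
  LinearEquiv.toContinuousLinearEquiv
    { toFun := fun p => (p.1 : ℂ) + (p.2 : ℂ) * (τ : ℂ)
      map_add' := fun p q => by simp; ring
      map_smul' := fun c p => by simp; ring
      invFun := fun z => (z.re - z.im / τ.im * τ.re, z.im / τ.im)
      left_inv := fun p => by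
        have := τ.im_pos.ne'
        ext <;> simp [this]
      right_inv := fun z => by
        have := τ.im_pos.ne'
        apply Complex.ext <;> simp [this] }

lemma tendsto_nhdsNE_torusCoord (τ : UpperHalfPlane) (p : ℝ × ℝ) :
    Tendsto (torusCoord τ) (𝓝[≠] p) (𝓝[≠] (torusCoord τ p)) :=
  tendsto_nhdsWithin_of_tendsto_nhds_of_eventually_within _
    ((torusCoord τ).continuous.continuousAt.tendsto.mono_left nhdsWithin_le_nhds)
    (eventually_nhdsWithin_of_forall fun _ h h' => h ((torusCoord τ).injective h'))

lemma integrableOn_torus (τ : UpperHalfPlane) {f : ℂ → ℂ}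
    (hc : ∀ p, ∀ᶠ x in 𝓝[≠] p, ContinuousAt f x)
    (hO : ∀ p, f =O[𝓝[≠] p] fun x => (x - p)⁻¹) :
    IntegrableOn (fun p : ℝ × ℝ => f ((p.1 : ℂ) + (p.2 : ℂ) * (τ : ℂ)))
      (Set.Ioc (0 : ℝ) 1 ×ˢ Set.Ioc (0 : ℝ) 1) := by
  have h : LocallyIntegrable (fun p : ℝ × ℝ => f (torusCoord τ p)) volume := by
    refine locallyIntegrable_of_isBigO_inv volume (by simp) (fun p => ?_) fun p => ?_
    · filter_upwards [(tendsto_nhdsNE_torusCoord τ p).eventually (hc (torusCoord τ p))] with x hx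
      exact hx.comp (torusCoord τ).continuous.continuousAt
    · refine ((hO (torusCoord τ p)).comp_tendsto (tendsto_nhdsNE_torusCoord τ p)).trans ?_
      have h1 : (fun x : ℝ × ℝ => ‖x - p‖) =O[𝓝[≠] p] fun x => torusCoord τ x - torusCoord τ p := by
        refine ((torusCoord τ).symm.toContinuousLinearMap.isBigO_comp
          (fun x => torusCoord τ x - torusCoord τ p) (𝓝[≠] p)).norm_left.congr_left fun x => ?_
        simp
      refine h1.inv_rev ?_ |>.congr_left fun x => rfl
      filter_upwards [self_mem_nhdsWithin] with x hx h0
      exact absurd (sub_eq_zero.1 (norm_eq_zero.1 h0)) hx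
  exact (h.integrableOn_isCompact (isCompact_Icc.prod isCompact_Icc)).mono_set
    (Set.prod_mono Set.Ioc_subset_Icc_self Set.Ioc_subset_Icc_self)

/-! ### Stokes' theorem on the torus -/

lemma countable_of_eventually_nhdsNE {X : Type*} [TopologicalSpace X]
    [SecondCountableTopology X] {P : X → Prop} (h : ∀ p, ∀ᶠ x in 𝓝[≠] p, P x) :
    {x | ¬ P x}.Countable := by
  obtain ⟨s, hs, hcov⟩ := TopologicalSpace.countable_cover_nhds
    (f := fun p => {x | x ≠ p → P x}) fun p => eventually_nhdsWithin_iff.1 (h p)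
  refine hs.mono fun x hx => ?_
  have : x ∈ ⋃ p ∈ s, {x | x ≠ p → P x} := hcov ▸ Set.mem_univ x
  simp only [Set.mem_iUnion] at this
  obtain ⟨p, hp, hxp⟩ := this
  by_cases hxp' : x = p
  · rwa [hxp']
  · exact absurd (hxp hxp') hx

/-- The integral of the derivative over a period vanishes along a line that avoids all
singularities. -/
lemma integral_fderiv_line_eq_zero {f : ℂ → ℂ} {z v : ℂ} (hv : f (z + v) = f z)
    (hf : ∀ s : ℝ, ContDiffAt ℝ 1 f (z + s * v)) :
    ∫ s in Set.Ioc (0 : ℝ) 1, fderiv ℝ f (z + s * v) v = 0 := by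
  rw [← intervalIntegral.integral_of_le zero_le_one]
  have hd : ∀ s : ℝ, HasDerivAt (fun s : ℝ => f (z + s * v)) (fderiv ℝ f (z + s * v) v) s := by
    intro s
    have h1 : HasDerivAt (fun s : ℝ => z + s * v) v s := by
      simpa using ((Complex.ofRealCLM.hasDerivAt (x := s)).mul_const v).const_add z
    exact ((hf s).differentiableAt (by simp)).hasFDerivAt.comp_hasDerivAt s h1
  have hcont : Continuous fun s : ℝ => fderiv ℝ f (z + s * v) v := by
    refine continuous_iff_continuousAt.2 fun s => ?_
    have h1 : ContinuousAt (fderiv ℝ f) (z + s * v) :=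
      ((hf s).fderiv_right (m := 0) (by simp)).continuousAt
    have h2 : ContinuousAt (fun s : ℝ => fderiv ℝ f (z + s * v)) s :=
      ContinuousAt.comp (g := fderiv ℝ f) h1 (by fun_prop)
    exact h2.clm_apply continuousAt_const
  rw [intervalIntegral.integral_eq_sub_of_hasDerivAt (fun s _ => hd s)
    (hcont.intervalIntegrable _ _)]
  simp [hv]

/-- Stokes' theorem on the torus for a function with isolated singularities whose derivatives
have at most simple poles in absolute value: almost every line in the direction of a period avoids
all singularities. -/
theorem torusIntegral_dz_dzbar_eq_zero {τ : UpperHalfPlane} {f : ℂ → ℂ}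
    (hp : IsLatticePeriodic τ f) (hf : ∀ p, ∀ᶠ z in 𝓝[≠] p, ContDiffAt ℝ 1 f z)
    (hO : ∀ p, fderiv ℝ f =O[𝓝[≠] p] fun z => (z - p)⁻¹) :
    torusIntegral τ (dz f) = 0 ∧ torusIntegral τ (dzbar f) = 0 := by
  have hS := countable_of_eventually_nhdsNE hf
  have hint : ∀ v : ℂ, IntegrableOn
      (fun p : ℝ × ℝ => fderiv ℝ f ((p.1 : ℂ) + (p.2 : ℂ) * (τ : ℂ)) v)
      (Set.Ioc (0 : ℝ) 1 ×ˢ Set.Ioc (0 : ℝ) 1) := by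
    intro v
    refine integrableOn_torus τ (f := fun z => fderiv ℝ f z v) (fun p => ?_) fun p => ?_
    · filter_upwards [hf p] with z hz
      exact ((hz.fderiv_right (m := 0) (by simp)).continuousAt).clm_apply continuousAt_const
    · refine IsBigO.trans ?_ (hO p)
      refine IsBigO.of_bound ‖v‖ (Eventually.of_forall fun z => ?_)
      rw [mul_comm]
      exact ContinuousLinearMap.le_opNorm _ _
  have hτ := τ.im_pos.ne'
  have hone : torusIntegral τ (fun z => fderiv ℝ f z 1) = 0 := by
    have hae : ∀ᵐ t : ℝ, ∀ s : ℝ, ContDiffAt ℝ 1 f (s + t * (τ : ℂ)) := by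
      have hc : ((fun z : ℂ => z.im / τ.im) '' {z | ¬ContDiffAt ℝ 1 f z}).Countable := hS.image _
      filter_upwards [hc.ae_notMem volume] with t ht s
      by_contra h
      exact ht ⟨_, h, by simp [hτ]⟩
    have hswap : torusIntegral τ (fun z => fderiv ℝ f z 1) =
        ∫ t in Set.Ioc (0 : ℝ) 1, ∫ s in Set.Ioc (0 : ℝ) 1,
          fderiv ℝ f ((s : ℂ) + (t : ℂ) * (τ : ℂ)) 1 := by
      have h1 := hint 1
      rw [IntegrableOn, Measure.volume_eq_prod, ← Measure.prod_restrict] at h1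
      have := integral_prod_symm _ h1
      rwa [Measure.prod_restrict] at this
    rw [hswap]
    refine integral_eq_zero_of_ae ?_
    filter_upwards [ae_restrict_of_ae hae] with t ht
    have := integral_fderiv_line_eq_zero (f := f) (z := t * (τ : ℂ)) (v := 1) (hp _).1
      fun s => by simpa [add_comm] using ht s
    simpa [add_comm] using this
  have htau : torusIntegral τ (fun z => fderiv ℝ f z τ) = 0 := by
    have hae : ∀ᵐ s : ℝ, ∀ t : ℝ, ContDiffAt ℝ 1 f (s + t * (τ : ℂ)) := by
      have hc : ((fun z : ℂ => z.re - z.im / τ.im * τ.re) ''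
        {z | ¬ContDiffAt ℝ 1 f z}).Countable := hS.image _
      filter_upwards [hc.ae_notMem volume] with s hs t
      by_contra h
      exact hs ⟨_, h, by simp [hτ]⟩
    have hswap : torusIntegral τ (fun z => fderiv ℝ f z τ) =
        ∫ s in Set.Ioc (0 : ℝ) 1, ∫ t in Set.Ioc (0 : ℝ) 1,
          fderiv ℝ f ((s : ℂ) + (t : ℂ) * (τ : ℂ)) τ := setIntegral_prod _ (hint τ)
    rw [hswap]
    refine integral_eq_zero_of_ae ?_
    filter_upwards [ae_restrict_of_ae hae] with s hs
    exact integral_fderiv_line_eq_zero (f := f) (z := s) (v := τ) (hp _).2 fun t => hs t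
  -- every real direction is a combination of the two periods
  have hI : torusIntegral τ (fun z => fderiv ℝ f z I) = 0 := by
    have e : ∀ z, fderiv ℝ f z I =
        (τ.im : ℂ)⁻¹ * fderiv ℝ f z τ - ((τ.im : ℂ)⁻¹ * τ.re) * fderiv ℝ f z 1 := by
      intro z
      have h1 : (τ : ℂ) = τ.re • (1 : ℂ) + τ.im • I := by
        apply Complex.ext <;> simp
      have h2 : fderiv ℝ f z τ = τ.re * fderiv ℝ f z 1 + τ.im * fderiv ℝ f z I := by
        rw [h1, map_add, map_smul, map_smul]
        simp
      have h3 : (τ.im : ℂ) ≠ 0 := by exact_mod_cast hτ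
      rw [h2]
      field_simp
      ring
    have h1 := hint 1
    have h2 := hint τ
    simp only [torusIntegral] at hone htau ⊢
    simp only [e]
    rw [integral_sub (h2.const_mul _) (h1.const_mul _), integral_const_mul, integral_const_mul,
      hone, htau]
    simp
  have h1 := hint 1
  have h2 := hint I
  constructor
  · simp only [torusIntegral, dz] at hone hI ⊢
    rw [integral_div, integral_sub h1 (h2.const_mul _), integral_const_mul, hone, hI]
    simp
  · simp only [torusIntegral, dzbar] at hone hI ⊢
    rw [integral_div, integral_add h1 (h2.const_mul _), integral_const_mul, hone, hI]
    simp

/-! ### Functions with holomorphic poles -/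

namespace HasHolomorphicPole

variable {f g : ℂ → ℂ} {N : ℕ} {p : ℂ}

lemma of_contDiffAt (hf : ∀ᶠ z in 𝓝 p, ContDiffAt ℝ ∞ f z) (N : ℕ) :
    HasHolomorphicPole f N p := by
  refine ⟨fun z => f z * (z - p) ^ N, ?_, ?_⟩
  · filter_upwards [hf] with z hz
    fun_prop
  · filter_upwards [self_mem_nhdsWithin] with z hz
    rw [mul_div_cancel_right₀ _ (pow_ne_zero _ (sub_ne_zero.2 hz))]

lemma mono (hf : HasHolomorphicPole f N p) {M : ℕ} (h : N ≤ M) : HasHolomorphicPole f M p := by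
  obtain ⟨u, hu, hfu⟩ := hf
  obtain ⟨k, rfl⟩ := Nat.exists_eq_add_of_le h
  refine ⟨fun z => u z * (z - p) ^ k, ?_, ?_⟩
  · filter_upwards [hu] with z hz
    fun_prop
  · filter_upwards [hfu, self_mem_nhdsWithin] with z hz hzp
    have : z - p ≠ 0 := sub_ne_zero.2 hzp
    rw [hz, pow_add, mul_div_mul_right _ _ (pow_ne_zero _ this)]

lemma add (hf : HasHolomorphicPole f N p) (hg : HasHolomorphicPole g N p) :
    HasHolomorphicPole (fun z => f z + g z) N p := by
  obtain ⟨u, hu, hfu⟩ := hf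
  obtain ⟨v, hv, hgv⟩ := hg
  refine ⟨fun z => u z + v z, ?_, ?_⟩
  · filter_upwards [hu, hv] with z hz hz'
    fun_prop
  · filter_upwards [hfu, hgv] with z hz hz'
    rw [hz, hz', add_div]

lemma mul_contDiffAt (hf : HasHolomorphicPole f N p) (hg : ∀ᶠ z in 𝓝 p, ContDiffAt ℝ ∞ g z) :
    HasHolomorphicPole (fun z => f z * g z) N p := by
  obtain ⟨u, hu, hfu⟩ := hf
  refine ⟨fun z => u z * g z, ?_, ?_⟩
  · filter_upwards [hu, hg] with z hz hz'
    fun_prop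
  · filter_upwards [hfu] with z hz
    rw [hz, div_mul_eq_mul_div]

lemma const_mul (c : ℂ) (hf : HasHolomorphicPole f N p) :
    HasHolomorphicPole (fun z => c * f z) N p := by
  simpa only [mul_comm c] using
    hf.mul_contDiffAt (g := fun _ => c) (Eventually.of_forall fun _ => contDiffAt_const)

lemma contDiffAt (hf : HasHolomorphicPole f N p) : ∀ᶠ z in 𝓝[≠] p, ContDiffAt ℝ ∞ f z := by
  obtain ⟨u, hu, hfu⟩ := hf
  filter_upwards [eventually_nhdsNE_eventually_nhds_iff.2 hfu, hu.filter_mono nhdsWithin_le_nhds,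
    self_mem_nhdsWithin] with z hz huz hzp
  refine ContDiffAt.congr_of_eventuallyEq ?_ hz
  have : z - p ≠ 0 := sub_ne_zero.2 hzp
  simp only [div_eq_mul_inv]
  exact huz.mul (ContDiffAt.inv (by fun_prop) (pow_ne_zero _ this))

lemma isBigO_inv (hf : HasHolomorphicPole f 1 p) : f =O[𝓝[≠] p] fun z => (z - p)⁻¹ := by
  obtain ⟨u, hu, hfu⟩ := hf
  have h1 : u =O[𝓝[≠] p] fun _ => (1 : ℂ) :=
    (hu.self_of_nhds.continuousAt.isBigO_one ℂ).mono nhdsWithin_le_nhds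
  have h2 := h1.mul (isBigO_refl (fun z => (z - p)⁻¹) (𝓝[≠] p))
  refine (h2.congr' ?_ (by simp))
  filter_upwards [hfu] with z hz
  rw [hz, pow_one, div_eq_mul_inv]

end HasHolomorphicPole

lemma torusIntegral_add {τ : UpperHalfPlane} {f g : ℂ → ℂ}
    (hf : ∀ p, HasHolomorphicPole f 1 p) (hg : ∀ p, HasHolomorphicPole g 1 p) :
    torusIntegral τ (fun z => f z + g z) = torusIntegral τ f + torusIntegral τ g :=
  integral_add
    (integrableOn_torus τ (fun p => (hf p).contDiffAt.mono fun _ h => h.continuousAt)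
      fun p => (hf p).isBigO_inv)
    (integrableOn_torus τ (fun p => (hg p).contDiffAt.mono fun _ h => h.continuousAt)
      fun p => (hg p).isBigO_inv)

lemma torusIntegral_const_mul (τ : UpperHalfPlane) (c : ℂ) (f : ℂ → ℂ) :
    torusIntegral τ (fun z => c * f z) = c * torusIntegral τ f :=
  integral_const_mul _ _

lemma torusIntegral_const (τ : UpperHalfPlane) (c : ℂ) : torusIntegral τ (fun _ => c) = c := by
  rw [torusIntegral, setIntegral_const, measureReal_def, Measure.volume_eq_prod,
    Measure.prod_prod]
  simp

lemma torusIntegral_congr {τ : UpperHalfPlane} {f g : ℂ → ℂ}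
    (h : ∀ p, ∀ᶠ z in 𝓝[≠] p, f z = g z) : torusIntegral τ f = torusIntegral τ g := by
  have hc := countable_of_eventually_nhdsNE h
  refine integral_congr_ae (ae_restrict_of_ae ?_)
  have hc' : ((torusCoord τ) ⁻¹' {z | ¬ f z = g z}).Countable :=
    hc.preimage (torusCoord τ).injective
  filter_upwards [hc'.ae_notMem volume] with p hp
  by_contra h
  exact hp h

/-! ### Regularized integrals -/

namespace HasRegIntegral

variable {τ : UpperHalfPlane} {f g : ℂ → ℂ} {I J : ℂ}

lemma congr (hf : HasRegIntegral τ f I) (h : ∀ p, ∀ᶠ z in 𝓝[≠] p, g z = f z) :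
    HasRegIntegral τ g I := by
  obtain ⟨a, b, ha, hb, hap, hbp, hfab, hI⟩ := hf
  refine ⟨a, b, ha, hb, hap, hbp, fun p => ?_, hI⟩
  filter_upwards [h p, hfab p] with z hz hz'
  rw [hz, hz']

lemma add (hf : HasRegIntegral τ f I) (hg : HasRegIntegral τ g J) :
    HasRegIntegral τ (fun z => f z + g z) (I + J) := by
  obtain ⟨a, b, ha, hb, hap, hbp, hfab, rfl⟩ := hf
  obtain ⟨a', b', ha', hb', hap', hbp', hgab, rfl⟩ := hg
  refine ⟨fun z => a z + a' z, fun z => b z + b' z, fun z => ?_, fun z => ?_,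
    fun p => (hap p).add (hap' p), fun p => ?_, fun p => ?_, torusIntegral_add hap hap'⟩
  · simp only [(ha z).1, (ha z).2, (ha' z).1, (ha' z).2, and_self]
  · simp only [(hb z).1, (hb z).2, (hb' z).1, (hb' z).2, and_self]
  · obtain ⟨N, hN⟩ := hbp p
    obtain ⟨M, hM⟩ := hbp' p
    exact ⟨max N M, (hN.mono (le_max_left _ _)).add (hM.mono (le_max_right _ _))⟩
  · obtain ⟨N, hN⟩ := hbp p
    obtain ⟨M, hM⟩ := hbp' p
    filter_upwards [hfab p, hgab p, hN.contDiffAt, hM.contDiffAt] with z h1 h2 h3 h4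
    rw [h1, h2, dz_add (h3.differentiableAt (by simp)) (h4.differentiableAt (by simp))]
    ring

lemma const_mul (c : ℂ) (hf : HasRegIntegral τ f I) :
    HasRegIntegral τ (fun z => c * f z) (c * I) := by
  obtain ⟨a, b, ha, hb, hap, hbp, hfab, rfl⟩ := hf
  refine ⟨fun z => c * a z, fun z => c * b z, fun z => ?_, fun z => ?_,
    fun p => (hap p).const_mul c, fun p => ?_, fun p => ?_, torusIntegral_const_mul τ c a⟩
  · simp only [(ha z).1, (ha z).2, and_self]
  · simp only [(hb z).1, (hb z).2, and_self]
  · obtain ⟨N, hN⟩ := hbp p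
    exact ⟨N, hN.const_mul c⟩
  · obtain ⟨N, hN⟩ := hbp p
    filter_upwards [hfab p, hN.contDiffAt] with z h1 h3
    rw [h1, dz_const_mul _ (h3.differentiableAt (by simp))]
    ring

/-- A function with at most simple poles is integrable, and its regularized integral is its
integral. -/
lemma of_simplePole (hf : IsLatticePeriodic τ f) (hp : ∀ p, HasHolomorphicPole f 1 p) :
    HasRegIntegral τ f (torusIntegral τ f) := by
  refine ⟨f, fun _ => 0, hf, fun z => ⟨rfl, rfl⟩, hp, fun p => ⟨0, ?_⟩, fun p => ?_, rfl⟩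
  · exact .of_contDiffAt (Eventually.of_forall fun _ => contDiffAt_const) 0
  · refine Eventually.of_forall fun z => ?_
    rw [dz_eq_deriv (differentiableAt_const _)]
    simp

lemma const (τ : UpperHalfPlane) (c : ℂ) : HasRegIntegral τ (fun _ => c) c := by
  have := of_simplePole (τ := τ) (f := fun _ => c) (fun z => ⟨rfl, rfl⟩)
    fun p => .of_contDiffAt (Eventually.of_forall fun _ => contDiffAt_const) 1
  rwa [torusIntegral_const] at this

lemma sum {ι : Type*} (s : Finset ι) {f : ι → ℂ → ℂ} {I : ι → ℂ}
    (h : ∀ i ∈ s, HasRegIntegral τ (f i) (I i)) :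
    HasRegIntegral τ (fun z => ∑ i ∈ s, f i z) (∑ i ∈ s, I i) := by
  classical
  induction s using Finset.induction_on with
  | empty => simpa using const τ 0
  | insert i s hi ih =>
    simp only [Finset.sum_insert hi]
    exact (h i (by simp)).add (ih fun j hj => h j (by simp [hj]))

/-- This says that regularized integrals are well defined. Let `a = -∂b`. The regularity lemma for the
Euler operator, applied to the numerator of `b`, shows that `∂̄b` is bounded, while `∂b` has simple
poles. So Stokes' theorem applies to `b`. -/
theorem eq_zero_of_zero (h : HasRegIntegral τ (fun _ => 0) I) : I = 0 := by
  obtain ⟨a, b, ha, hb, hap, hbp, hab, rfl⟩ := h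
  have hdz : ∀ p, ∀ᶠ z in 𝓝[≠] p, -1 * dz b z = a z := by
    intro p
    filter_upwards [hab p] with z hz
    linear_combination hz
  have hbd : ∀ p, ∀ᶠ z in 𝓝[≠] p, ContDiffAt ℝ ∞ b z := fun p => by
    obtain ⟨N, hN⟩ := hbp p
    exact hN.contDiffAt
  rw [← torusIntegral_congr hdz, torusIntegral_const_mul,
    (torusIntegral_dz_dzbar_eq_zero hb (fun p => (hbd p).mono fun z hz => hz.of_le (by simp))
      fun p => ?_).1, mul_zero]
  have h1 : dz b =O[𝓝[≠] p] fun z => (z - p)⁻¹ := by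
    refine ((hap p).isBigO_inv.const_mul_left (-1)).congr' ?_ EventuallyEq.rfl
    filter_upwards [hdz p] with z hz
    linear_combination hz
  have h2 : dzbar b =O[𝓝[≠] p] fun z => (z - p)⁻¹ := by
    obtain ⟨N, h, hh, hbh⟩ := hbp p
    obtain ⟨g, hg, hag⟩ := hap p
    -- the equation `a = -∂b` in terms of the numerators of `a` and `b`
    have heuler : ∀ᶠ z in 𝓝[≠] p, (z - p) * dz h z - N * h z = (z - p) ^ N * (-g z) := by
      filter_upwards [eventually_nhdsNE_eventually_nhds_iff.2 hbh, hag, hdz p,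
        hh.filter_mono nhdsWithin_le_nhds, self_mem_nhdsWithin, hbd p] with z e1 e2 e3 e4 e5 e6
      have hzp : z - p ≠ 0 := sub_ne_zero.2 e5
      have hbz : DifferentiableAt ℝ b z := e6.differentiableAt (by simp)
      have e7 : h =ᶠ[𝓝 z] fun y => (y - p) ^ N * b y := by
        filter_upwards [e1, isOpen_ne.mem_nhds e5] with y hy hyp
        rw [hy, mul_div_cancel₀ _ (pow_ne_zero _ (sub_ne_zero.2 hyp))]
      have e8 := e7.dz_eq
      have p2 : dz (fun z => (z - p) ^ N) z = N * (z - p) ^ (N - 1) := by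
        rw [dz_eq_deriv (by fun_prop), deriv_fun_pow (by fun_prop)]
        simp
      rw [dz_mul (by fun_prop) hbz, p2] at e8
      have e9 : dz b z = -(g z / (z - p)) := by
        rw [pow_one] at e2
        rw [← e2]
        linear_combination -e3
      rw [e8, e7.eq_of_nhds, e9]
      rcases N with _ | N
      · simp
        field_simp
      · simp only [Nat.add_sub_cancel, pow_succ]
        field_simp
        ring
    have heuler' : ∀ᶠ z in 𝓝 p, (z - p) * dz h z - N * h z = (z - p) ^ N * (-g z) := by
      have c1 := (contDiffAt_dz hh.self_of_nhds).continuousAt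
      have c2 := hh.self_of_nhds.continuousAt
      have c3 := hg.self_of_nhds.continuousAt
      have hp : (p - p) * dz h p - N * h p = (p - p) ^ N * (-g p) := by
        have cl : Tendsto (fun z => (z - p) * dz h z - N * h z) (𝓝[≠] p)
            (𝓝 ((p - p) * dz h p - N * h p)) :=
          (ContinuousAt.tendsto (f := fun z => (z - p) * dz h z - N * h z)
            (by fun_prop)).mono_left nhdsWithin_le_nhds
        have cr : Tendsto (fun z => (z - p) ^ N * (-g z)) (𝓝[≠] p)
            (𝓝 ((p - p) ^ N * (-g p))) :=
          (ContinuousAt.tendsto (f := fun z => (z - p) ^ N * (-g z))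
            (by fun_prop)).mono_left nhdsWithin_le_nhds
        exact tendsto_nhds_unique (cl.congr' heuler) cr
      filter_upwards [eventually_nhdsWithin_iff.1 heuler] with z hz
      by_cases hzp : z = p
      · rw [hzp]; exact hp
      · exact hz hzp
    have hO := ((isBigO_of_euler N N le_rfl h (fun z => -g z) hh
      (hg.mono fun z hz => hz.neg) heuler').2).mono nhdsWithin_le_nhds (l := 𝓝[≠] p)
    have hO1 : dzbar b =O[𝓝[≠] p] fun _ => (1 : ℂ) := by
      refine (hO.mul (isBigO_refl (fun z => ((z - p) ^ N)⁻¹) _)).congr' ?_ ?_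
      · filter_upwards [eventually_nhdsNE_eventually_nhds_iff.2 hbh,
          hh.filter_mono nhdsWithin_le_nhds, self_mem_nhdsWithin] with z e1 e4 e5
        have hzp : z - p ≠ 0 := sub_ne_zero.2 e5
        have e2 : b =ᶠ[𝓝 z] fun y => h y * ((y - p) ^ N)⁻¹ := by
          filter_upwards [e1] with y hy
          rw [hy, div_eq_mul_inv]
        have hol : DifferentiableAt ℂ (fun y => ((y - p) ^ N)⁻¹) z :=
          DifferentiableAt.inv (by fun_prop) (pow_ne_zero _ hzp)
        rw [e2.dzbar_eq, dzbar_mul (e4.differentiableAt (by simp)) (hol.restrictScalars ℝ),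
          dzbar_eq_zero hol]
        ring
      · filter_upwards [self_mem_nhdsWithin] with z e5
        exact mul_inv_cancel₀ (pow_ne_zero _ (sub_ne_zero.2 e5))
    refine hO1.trans ?_
    have c : Tendsto (fun z => z - p) (𝓝[≠] p) (𝓝 0) := by
      have : Tendsto (fun z => z - p) (𝓝 p) (𝓝 (p - p)) :=
        (continuous_id.sub continuous_const).tendsto p
      rw [sub_self] at this
      exact this.mono_left nhdsWithin_le_nhds
    refine ((c.isBigO_one ℂ).inv_rev ?_).congr_left fun _ => inv_one
    filter_upwards [self_mem_nhdsWithin] with z e5 h0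
    exact absurd (sub_eq_zero.1 h0) e5
  refine IsBigO.trans (IsBigO.of_bound 1 ?_) (h1.norm_left.add h2.norm_left)
  refine Eventually.of_forall fun z => ?_
  rw [one_mul, Real.norm_of_nonneg (by positivity)]
  exact norm_fderiv_le b z

theorem unique (h : HasRegIntegral τ f I) (h' : HasRegIntegral τ f J) : I = J := by
  have h0 := (h.add (h'.const_mul (-1))).congr (g := fun _ => 0)
    fun p => Eventually.of_forall fun z => by ring
  linear_combination h0.eq_zero_of_zero

lemma regIntegrable (h : HasRegIntegral τ f I) : RegIntegrable τ f := ⟨I, h⟩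

lemma regIntegral_eq (h : HasRegIntegral τ f I) : regIntegral τ f = I := by
  rw [regIntegral, dif_pos h.regIntegrable]
  exact h.regIntegrable.choose_spec.unique h

end HasRegIntegral

/-! ### The Laurent coefficients of the Kronecker function -/

lemma theta_eq_zero {τ : UpperHalfPlane} {z : ℂ} (hz : z ∈ lattice τ) : theta τ z = 0 := by
  classical
  have h : IsLatticePeriodic τ fun z => if theta τ z = 0 then 1 else 0 := by
    intro z
    simp [theta_add_one, theta_add_tau, Complex.exp_ne_zero]
  by_contra hne
  have := h.add_mem hz 0
  simp [theta_zero, hne] at this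

/-- The entire function `θ(z) / z`. -/
def thetaDiv (τ : UpperHalfPlane) : ℂ → ℂ := dslope (theta τ) 0

lemma differentiable_thetaDiv (τ : UpperHalfPlane) : Differentiable ℂ (thetaDiv τ) := fun _ =>
  ((Complex.differentiableOn_dslope Filter.univ_mem).2
    (differentiable_theta τ).differentiableOn).differentiableAt Filter.univ_mem

lemma theta_eq_mul_thetaDiv (τ : UpperHalfPlane) (z : ℂ) : theta τ z = z * thetaDiv τ z := by
  have := sub_smul_dslope (theta τ) 0 z
  rw [theta_zero, sub_zero, sub_zero, smul_eq_mul] at this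
  exact this.symm

lemma thetaDiv_zero (τ : UpperHalfPlane) : thetaDiv τ 0 = 1 := by
  rw [thetaDiv, dslope_same, deriv_theta_zero]

lemma thetaDiv_neg (τ : UpperHalfPlane) (z : ℂ) : thetaDiv τ (-z) = thetaDiv τ z := by
  by_cases hz : z = 0
  · simp [hz]
  · have h := theta_neg τ z
    rw [theta_eq_mul_thetaDiv, theta_eq_mul_thetaDiv] at h
    apply mul_left_cancel₀ (neg_ne_zero.2 hz)
    linear_combination h

lemma eventually_thetaDiv_ne_zero (τ : UpperHalfPlane) : ∀ᶠ z in 𝓝 0, thetaDiv τ z ≠ 0 :=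
  (differentiable_thetaDiv τ 0).continuousAt.eventually_ne (by simp [thetaDiv_zero])

lemma eventually_notMem_lattice_of_notMem {τ : UpperHalfPlane} {p : ℂ} (hp : p ∉ lattice τ) :
    ∀ᶠ z in 𝓝 p, z ∉ lattice τ := by
  filter_upwards [(differentiable_theta τ p).continuousAt.eventually_ne (theta_ne_zero hp)]
    with z hz hzl
  exact hz (theta_eq_zero hzl)

lemma eventually_notMem_lattice (τ : UpperHalfPlane) (p : ℂ) :
    ∀ᶠ z in 𝓝[≠] p, z ∉ lattice τ := by
  by_cases hp : p ∈ lattice τ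
  · have hc : Tendsto (fun z => z - p) (𝓝[≠] p) (𝓝 0) := by
      have : Tendsto (fun z => z - p) (𝓝 p) (𝓝 (p - p)) :=
        (continuous_id.sub continuous_const).tendsto p
      rw [sub_self] at this
      exact this.mono_left nhdsWithin_le_nhds
    filter_upwards [hc.eventually (eventually_thetaDiv_ne_zero τ), self_mem_nhdsWithin]
      with z hz hzp hzl
    have h := theta_eq_zero ((lattice τ).sub_mem hzl hp)
    rw [theta_eq_mul_thetaDiv] at h
    exact mul_ne_zero (sub_ne_zero.2 hzp) hz h
  · exact (eventually_notMem_lattice_of_notMem hp).filter_mono nhdsWithin_le_nhds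

lemma anomaly_add_one (τ : UpperHalfPlane) (z : ℂ) : anomaly τ (z + 1) = anomaly τ z := by
  simp [anomaly]

lemma anomaly_add_tau (τ : UpperHalfPlane) (z : ℂ) :
    anomaly τ (z + τ) = anomaly τ z + 2 * Real.pi * I := by
  have h : (starRingEnd ℂ) (τ : ℂ) = τ - 2 * τ.im * I := by
    apply Complex.ext <;> simp
    ring
  have hτ : (τ.im : ℂ) ≠ 0 := by exact_mod_cast τ.im_pos.ne'
  simp only [anomaly, map_add, h]
  push_cast
  field_simp
  ring

lemma kroneckerHat_periodic (τ : UpperHalfPlane) (c : ℂ) :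
    IsLatticePeriodic τ (kroneckerHat τ c) := by
  intro z
  constructor
  · rw [kroneckerHat, kroneckerHat, anomaly_add_one, add_right_comm, theta_add_one, theta_add_one,
      neg_mul, neg_div_neg_eq]
  · rw [kroneckerHat, kroneckerHat, anomaly_add_tau, add_right_comm, theta_add_tau, theta_add_tau]
    have h : cexp (c * (anomaly τ z + 2 * Real.pi * I)) *
        -cexp (-(Real.pi * I * τ) - 2 * Real.pi * I * (z + c)) =
        -cexp (-(Real.pi * I * τ) - 2 * Real.pi * I * z) * cexp (c * anomaly τ z) := by
      rw [mul_neg, neg_mul, ← Complex.exp_add, ← Complex.exp_add]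
      ring_nf
    rw [← mul_div_assoc, ← mul_assoc, h, mul_assoc (-cexp _) (cexp _),
      mul_assoc (-cexp _) (theta τ z),
      mul_div_mul_left _ _ (neg_ne_zero.2 (Complex.exp_ne_zero _)), mul_div_assoc]

lemma BHat_periodic (τ : UpperHalfPlane) (m : ℕ) : IsLatticePeriodic τ (BHat τ m) := by
  intro z
  have h1 : kroneckerHatRegular τ (z + 1) = kroneckerHatRegular τ z := by
    simp only [kroneckerHatRegular, (kroneckerHat_periodic τ _ z).1]
  have h2 : kroneckerHatRegular τ (z + τ) = kroneckerHatRegular τ z := by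
    simp only [kroneckerHatRegular, (kroneckerHat_periodic τ _ z).2]
  rw [BHat, BHat, BHat, h1, h2]
  exact ⟨rfl, rfl⟩

lemma kroneckerHatRegular_eq {τ : UpperHalfPlane} (z : ℂ) :
    kroneckerHatRegular τ z = fun c =>
      (theta τ z)⁻¹ * (cexp (c * anomaly τ z) * (theta τ (z + c) * (thetaDiv τ c)⁻¹)) := by
  have hne : ∀ c, c ≠ 0 → c * kroneckerHat τ c z =
      (theta τ z)⁻¹ * (cexp (c * anomaly τ z) * (theta τ (z + c) * (thetaDiv τ c)⁻¹)) := by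
    intro c hc
    rw [kroneckerHat, theta_eq_mul_thetaDiv τ c, div_eq_mul_inv, mul_inv, mul_inv]
    field_simp
  funext c
  by_cases hc : c = 0
  · subst hc
    rw [kroneckerHatRegular, Function.update_self]
    apply Tendsto.limUnder_eq
    have hcont : ContinuousAt (fun c => (theta τ z)⁻¹ *
        (cexp (c * anomaly τ z) * (theta τ (z + c) * (thetaDiv τ c)⁻¹))) 0 := by
      have h1 : ContinuousAt (fun c => (thetaDiv τ c)⁻¹) 0 :=
        (differentiable_thetaDiv τ 0).continuousAt.inv₀ (by simp [thetaDiv_zero])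
      have h2 := (differentiable_theta τ).continuous
      have h3 : ContinuousAt (fun c => theta τ (z + c)) 0 := by fun_prop
      have h4 : ContinuousAt (fun c => cexp (c * anomaly τ z)) 0 := by fun_prop
      exact continuousAt_const.mul (h4.mul (h3.mul h1))
    refine (hcont.tendsto.mono_left nhdsWithin_le_nhds).congr' ?_
    filter_upwards [self_mem_nhdsWithin] with c hc
    exact (hne c hc).symm
  · rw [kroneckerHatRegular, Function.update_of_ne hc, hne c hc]

/-- The `k`-th Taylor coefficient, times `k!`, of `θ(z + c) c / θ(c)` at `c = 0`. -/
def thetaTaylor (τ : UpperHalfPlane) (k : ℕ) (z : ℂ) : ℂ :=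
  ∑ j ∈ Finset.range (k + 1), (k.choose j : ℂ) * iteratedDeriv j (theta τ) z *
    iteratedDeriv (k - j) (fun c => (thetaDiv τ c)⁻¹) 0

lemma contDiffAt_inv_thetaDiv (τ : UpperHalfPlane) (n : ℕ) :
    ContDiffAt ℂ n (fun c => (thetaDiv τ c)⁻¹) 0 :=
  (differentiable_thetaDiv τ).contDiff.contDiffAt.inv (by simp [thetaDiv_zero])

lemma iteratedDeriv_theta_mul_inv (τ : UpperHalfPlane) (k : ℕ) (z : ℂ) :
    iteratedDeriv k (fun c => theta τ (z + c) * (thetaDiv τ c)⁻¹) 0 = thetaTaylor τ k z := by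
  have h : ContDiff ℂ k (fun c => theta τ (z + c)) := by
    have : ContDiff ℂ k (theta τ) := (differentiable_theta τ).contDiff
    fun_prop
  rw [iteratedDeriv_fun_mul h.contDiffAt (contDiffAt_inv_thetaDiv τ k), thetaTaylor]
  simp only [iteratedDeriv_comp_const_add, add_zero]

/-- The function `θ(z) B̂_m(z)`, which is smooth on `ℂ`. -/
def BHatNum (τ : UpperHalfPlane) (m : ℕ) (z : ℂ) : ℂ :=
  ∑ i ∈ Finset.range (m + 1), (m.choose i : ℂ) * anomaly τ z ^ i * thetaTaylor τ (m - i) z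

lemma BHat_eq_div (τ : UpperHalfPlane) (m : ℕ) (z : ℂ) :
    BHat τ m z = BHatNum τ m z / theta τ z := by
  have h1 : ContDiffAt ℂ m (fun c => theta τ (z + c) * (thetaDiv τ c)⁻¹) 0 := by
    have : ContDiff ℂ m (theta τ) := (differentiable_theta τ).contDiff
    exact ContDiffAt.mul (by fun_prop) (contDiffAt_inv_thetaDiv τ m)
  have h2 : ContDiffAt ℂ m (fun c => cexp (c * anomaly τ z)) 0 := by fun_prop
  rw [BHat, kroneckerHatRegular_eq, iteratedDeriv_const_mul_field, iteratedDeriv_fun_mul h2 h1,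
    BHatNum, div_eq_inv_mul]
  congr 1
  refine Finset.sum_congr rfl fun i _ => ?_
  rw [iteratedDeriv_theta_mul_inv]
  congr 2
  have : (fun c => cexp (c * anomaly τ z)) = fun c => cexp (anomaly τ z * c) := by
    simp only [mul_comm]
  rw [this, iteratedDeriv_cexp_const_mul]
  simp

lemma differentiable_thetaTaylor (τ : UpperHalfPlane) (k : ℕ) :
    Differentiable ℂ (thetaTaylor τ k) := by
  have h : ∀ j, Differentiable ℂ (iteratedDeriv j (theta τ)) := fun j =>
    ((differentiable_theta τ).contDiff (n := j + 1)).differentiable_iteratedDeriv j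
      (by exact_mod_cast Nat.lt_succ_self j)
  unfold thetaTaylor
  fun_prop

lemma contDiff_of_differentiable {f : ℂ → ℂ} (hf : Differentiable ℂ f) : ContDiff ℝ ∞ f :=
  (hf.contDiff (n := ∞)).restrict_scalars ℝ

lemma contDiff_anomaly (τ : UpperHalfPlane) : ContDiff ℝ ∞ (anomaly τ) := by
  have : ContDiff ℝ ∞ (fun z : ℂ => starRingEnd ℂ z) := Complex.conjCLE.contDiff
  unfold anomaly
  fun_prop

lemma contDiff_BHatNum (τ : UpperHalfPlane) (m : ℕ) : ContDiff ℝ ∞ (BHatNum τ m) := by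
  have h1 := contDiff_anomaly τ
  have h2 := fun k => contDiff_of_differentiable (differentiable_thetaTaylor τ k)
  unfold BHatNum
  fun_prop

lemma dzbar_anomaly (τ : UpperHalfPlane) (z : ℂ) :
    dzbar (anomaly τ) z = -((Real.pi / τ.im : ℝ) : ℂ) := by
  have h : HasFDerivAt (anomaly τ) (-((Real.pi / τ.im : ℝ) : ℂ) •
      ((Complex.conjCLE : ℂ →L[ℝ] ℂ) - ContinuousLinearMap.id ℝ ℂ)) z :=
    ((Complex.conjCLE : ℂ →L[ℝ] ℂ).hasFDerivAt.sub (hasFDerivAt_id z)).const_mul _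
  rw [dzbar, h.fderiv]
  simp
  linear_combination ((Real.pi : ℂ) / τ.im) * I_sq

lemma dzbar_pow {f : ℂ → ℂ} {z : ℂ} (hf : DifferentiableAt ℝ f z) (n : ℕ) :
    dzbar (fun z => f z ^ (n + 1)) z = (n + 1) * f z ^ n * dzbar f z := by
  induction n with
  | zero => simp
  | succ n ih =>
    have : (fun z => f z ^ (n + 1 + 1)) = fun z => f z ^ (n + 1) * f z := by
      funext z; rw [pow_succ]
    rw [this, dzbar_mul (by fun_prop) hf, ih]
    push_cast
    ring

lemma dzbar_sum {ι : Type*} (s : Finset ι) {f : ι → ℂ → ℂ} {z : ℂ}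
    (h : ∀ i ∈ s, DifferentiableAt ℝ (f i) z) :
    dzbar (fun z => ∑ i ∈ s, f i z) z = ∑ i ∈ s, dzbar (f i) z := by
  simp only [dzbar, fderiv_fun_sum h, sum_apply, Finset.mul_sum,
    ← Finset.sum_add_distrib, Finset.sum_div]

lemma dzbar_BHatNum_succ (τ : UpperHalfPlane) (m : ℕ) (z : ℂ) :
    dzbar (BHatNum τ (m + 1)) z =
      -((Real.pi / τ.im : ℝ) : ℂ) * (m + 1) * BHatNum τ m z := by
  have hA : DifferentiableAt ℝ (anomaly τ) z := (contDiff_anomaly τ).differentiable (by simp) z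
  have hT : ∀ k, DifferentiableAt ℂ (thetaTaylor τ k) z := fun k => differentiable_thetaTaylor τ k z
  have hT' : ∀ k, DifferentiableAt ℝ (thetaTaylor τ k) z := fun k => (hT k).restrictScalars ℝ
  have e : BHatNum τ (m + 1) = fun z => ∑ i ∈ Finset.range (m + 2),
      ((m + 1).choose i : ℂ) * anomaly τ z ^ i * thetaTaylor τ (m + 1 - i) z := rfl
  rw [e, dzbar_sum _ (fun i _ => by fun_prop), Finset.sum_range_succ', BHatNum, Finset.mul_sum]
  have h0 : dzbar (fun z => ((m + 1).choose 0 : ℂ) * anomaly τ z ^ 0 *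
      thetaTaylor τ (m + 1 - 0) z) z = 0 := by
    apply dzbar_eq_zero
    simp only [pow_zero]
    fun_prop
  rw [h0, add_zero]
  refine Finset.sum_congr rfl fun i _ => ?_
  rw [dzbar_mul (by fun_prop) (hT' _), dzbar_const_mul _ (by fun_prop), dzbar_pow hA,
    dzbar_eq_zero (hT _), dzbar_anomaly, Nat.add_sub_add_right]
  have hch : ((m + 1).choose (i + 1) : ℂ) * (i + 1) = (m + 1) * m.choose i := by
    exact_mod_cast (Nat.add_one_mul_choose_eq m i).symm
  linear_combination (-((Real.pi / τ.im : ℝ) : ℂ) * anomaly τ z ^ i * thetaTaylor τ (m - i) z) * hch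

lemma BHatNum_zero_index (τ : UpperHalfPlane) (z : ℂ) : BHatNum τ 0 z = theta τ z := by
  simp [BHatNum, thetaTaylor, thetaDiv_zero]

lemma BHatNum_zero (τ : UpperHalfPlane) (m : ℕ) :
    BHatNum τ m 0 = if m = 1 then 1 else 0 := by
  have h1 : BHatNum τ m 0 = thetaTaylor τ m 0 := by
    rw [BHatNum, Finset.sum_range_succ']
    simp [anomaly]
  have h2 : (fun c => theta τ (0 + c) * (thetaDiv τ c)⁻¹) =ᶠ[𝓝 0] fun c => c := by
    filter_upwards [eventually_thetaDiv_ne_zero τ] with c hc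
    rw [zero_add, theta_eq_mul_thetaDiv, mul_inv_cancel_right₀ hc]
  rw [h1, ← iteratedDeriv_theta_mul_inv, h2.iteratedDeriv_eq]
  have : (fun c : ℂ => c) = id := rfl
  rcases m with _ | _ | m
  · simp
  · simp
  · rw [iteratedDeriv_succ', iteratedDeriv_succ']
    simp

/-! ### Simple poles with residues -/

/-- Near `p`, off `p` itself, `f` is a smooth function divided by `z - p`, and the value of that
smooth function at `p` is `r`. -/
def HasResidue (f : ℂ → ℂ) (r p : ℂ) : Prop :=
  ∃ u : ℂ → ℂ, (∀ᶠ z in 𝓝 p, ContDiffAt ℝ ∞ u z) ∧ u p = r ∧ ∀ᶠ z in 𝓝[≠] p, f z = u z / (z - p)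

namespace HasResidue

variable {f g : ℂ → ℂ} {r s p : ℂ}

lemma hasHolomorphicPole (h : HasResidue f r p) : HasHolomorphicPole f 1 p := by
  obtain ⟨u, hu, -, hf⟩ := h
  exact ⟨u, hu, by simpa using hf⟩

lemma of_contDiffAt (hf : ∀ᶠ z in 𝓝 p, ContDiffAt ℝ ∞ f z) : HasResidue f 0 p := by
  refine ⟨fun z => f z * (z - p), ?_, by simp, ?_⟩
  · filter_upwards [hf] with z hz
    fun_prop
  · filter_upwards [self_mem_nhdsWithin] with z hz
    rw [mul_div_cancel_right₀ _ (sub_ne_zero.2 hz)]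

lemma add (hf : HasResidue f r p) (hg : HasResidue g s p) :
    HasResidue (fun z => f z + g z) (r + s) p := by
  obtain ⟨u, hu, rfl, hfu⟩ := hf
  obtain ⟨v, hv, rfl, hgv⟩ := hg
  refine ⟨fun z => u z + v z, ?_, rfl, ?_⟩
  · filter_upwards [hu, hv] with z hz hz'
    fun_prop
  · filter_upwards [hfu, hgv] with z hz hz'
    rw [hz, hz', add_div]

lemma mul_contDiffAt (hf : HasResidue f r p) (hg : ∀ᶠ z in 𝓝 p, ContDiffAt ℝ ∞ g z) :
    HasResidue (fun z => f z * g z) (r * g p) p := by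
  obtain ⟨u, hu, rfl, hfu⟩ := hf
  refine ⟨fun z => u z * g z, ?_, rfl, ?_⟩
  · filter_upwards [hu, hg] with z hz hz'
    fun_prop
  · filter_upwards [hfu] with z hz
    rw [hz, div_mul_eq_mul_div]

lemma const_mul (c : ℂ) (hf : HasResidue f r p) : HasResidue (fun z => c * f z) (c * r) p := by
  simpa only [mul_comm c] using
    hf.mul_contDiffAt (g := fun _ => c) (Eventually.of_forall fun _ => contDiffAt_const)

lemma comp_const_add (x : ℂ) (hf : HasResidue f r (x + p)) :
    HasResidue (fun z => f (x + z)) r p := by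
  obtain ⟨u, hu, rfl, hfu⟩ := hf
  have hc : Tendsto (fun z => x + z) (𝓝 p) (𝓝 (x + p)) := (by fun_prop : Continuous _).tendsto p
  refine ⟨fun z => u (x + z), ?_, rfl, ?_⟩
  · filter_upwards [hc.eventually hu] with z hz
    exact ContDiffAt.comp (g := u) z hz (by fun_prop)
  · filter_upwards [hc.eventually (eventually_nhdsWithin_iff.1 hfu) |>.filter_mono
      nhdsWithin_le_nhds, self_mem_nhdsWithin] with z hz hzp
    rw [hz (fun h => hzp (add_left_cancel h))]
    congr 1
    ring

lemma comp_const_sub (y : ℂ) (hf : HasResidue f r (y - p)) :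
    HasResidue (fun z => f (y - z)) (-r) p := by
  obtain ⟨u, hu, rfl, hfu⟩ := hf
  have hc : Tendsto (fun z => y - z) (𝓝 p) (𝓝 (y - p)) := (by fun_prop : Continuous _).tendsto p
  refine ⟨fun z => -u (y - z), ?_, rfl, ?_⟩
  · filter_upwards [hc.eventually hu] with z hz
    exact (ContDiffAt.comp (g := u) z hz (by fun_prop)).neg
  · filter_upwards [hc.eventually (eventually_nhdsWithin_iff.1 hfu) |>.filter_mono
      nhdsWithin_le_nhds, self_mem_nhdsWithin] with z hz hzp
    rw [hz (fun h => hzp (sub_right_inj.1 h)), neg_div, ← div_neg]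
    congr 1
    ring

/-- At a pole without residue the total derivative is integrable, even though `f` need not be
continuous: it may behave like `(z̄ - p̄) / (z - p)`. -/
lemma fderiv_isBigO (hf : HasResidue f 0 p) : fderiv ℝ f =O[𝓝[≠] p] fun z => (z - p)⁻¹ := by
  have hfd := hf.hasHolomorphicPole.contDiffAt
  obtain ⟨u, hu, hu0, hfu⟩ := hf
  have hder : ∀ᶠ z in 𝓝[≠] p, dz f z = dz u z * (z - p)⁻¹ - u z * ((z - p)⁻¹ * (z - p)⁻¹) ∧
      dzbar f z = dzbar u z * (z - p)⁻¹ := by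
    filter_upwards [eventually_nhdsNE_eventually_nhds_iff.2 hfu,
      hu.filter_mono nhdsWithin_le_nhds, self_mem_nhdsWithin] with z e1 e2 e3
    have hzp : z - p ≠ 0 := sub_ne_zero.2 e3
    have e4 : f =ᶠ[𝓝 z] fun y => u y * (y - p)⁻¹ := by
      filter_upwards [e1] with y hy
      rw [hy, div_eq_mul_inv]
    have hol : HasDerivAt (fun y => (y - p)⁻¹) (-1 / (z - p) ^ 2) z :=
      ((hasDerivAt_id z).sub_const p).inv hzp
    have hud : DifferentiableAt ℝ u z := e2.differentiableAt (by simp)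
    have hold := hol.differentiableAt
    constructor
    · rw [e4.dz_eq, dz_mul hud (hold.restrictScalars ℝ), dz_eq_deriv hold, hol.deriv]
      field_simp
      ring
    · rw [e4.dzbar_eq, dzbar_mul hud (hold.restrictScalars ℝ), dzbar_eq_zero hold]
      ring
  have hrefl := isBigO_refl (fun z : ℂ => (z - p)⁻¹) (𝓝[≠] p)
  have b1 : dz u =O[𝓝[≠] p] fun _ => (1 : ℂ) :=
    ((contDiffAt_dz hu.self_of_nhds).continuousAt.isBigO_one ℂ).mono nhdsWithin_le_nhds
  have b2 : dzbar u =O[𝓝[≠] p] fun _ => (1 : ℂ) :=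
    ((contDiffAt_dzbar hu.self_of_nhds).continuousAt.isBigO_one ℂ).mono nhdsWithin_le_nhds
  have b3 : u =O[𝓝[≠] p] fun z => z - p := by
    have := (hu.self_of_nhds.differentiableAt (by simp)).isBigO_sub.mono
      (nhdsWithin_le_nhds (s := {p}ᶜ))
    simpa [hu0] using this
  have c3 : (fun z => u z * ((z - p)⁻¹ * (z - p)⁻¹)) =O[𝓝[≠] p] fun z => (z - p)⁻¹ := by
    refine (b3.mul (hrefl.mul hrefl)).congr' EventuallyEq.rfl ?_
    filter_upwards [self_mem_nhdsWithin] with z hz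
    rw [mul_inv_cancel_left₀ (sub_ne_zero.2 hz)]
  have c1 : (fun z => dz u z * (z - p)⁻¹) =O[𝓝[≠] p] fun z => (z - p)⁻¹ := by
    simpa using b1.mul hrefl
  have c2 : (fun z => dzbar u z * (z - p)⁻¹) =O[𝓝[≠] p] fun z => (z - p)⁻¹ := by
    simpa using b2.mul hrefl
  have d1 : dz f =O[𝓝[≠] p] fun z => (z - p)⁻¹ := by
    refine (c1.sub c3).congr' ?_ EventuallyEq.rfl
    filter_upwards [hder] with z hz
    exact hz.1.symm
  have d2 : dzbar f =O[𝓝[≠] p] fun z => (z - p)⁻¹ := by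
    refine c2.congr' ?_ EventuallyEq.rfl
    filter_upwards [hder] with z hz
    exact hz.2.symm
  refine IsBigO.trans (IsBigO.of_bound 1 ?_) (d1.norm_left.add d2.norm_left)
  refine Eventually.of_forall fun z => ?_
  rw [one_mul, Real.norm_of_nonneg (by positivity)]
  exact norm_fderiv_le f z

end HasResidue

theorem torusIntegral_dzbar_eq_zero {τ : UpperHalfPlane} {f : ℂ → ℂ}
    (hp : IsLatticePeriodic τ f) (hf : ∀ p, HasResidue f 0 p) : torusIntegral τ (dzbar f) = 0 :=
  (torusIntegral_dz_dzbar_eq_zero hp (fun p => (hf p).hasHolomorphicPole.contDiffAt.mono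
    fun _ h => h.of_le (by simp)) fun p => (hf p).fderiv_isBigO).2

/-! ### The normalized coefficients and their convolution -/

/-- `B̂_m(z) / m!`, the coefficient of `c ^ (m - 1)` in the completed Kronecker theta function. -/
def bCoeff (τ : UpperHalfPlane) (m : ℕ) (z : ℂ) : ℂ := BHat τ m z / m.factorial

lemma bCoeff_periodic (τ : UpperHalfPlane) (m : ℕ) : IsLatticePeriodic τ (bCoeff τ m) := by
  intro z
  simp only [bCoeff, (BHat_periodic τ m z).1, (BHat_periodic τ m z).2, and_self]

lemma bCoeff_eq_div (τ : UpperHalfPlane) (m : ℕ) (z : ℂ) :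
    bCoeff τ m z = (m.factorial : ℂ)⁻¹ * BHatNum τ m z * (theta τ z)⁻¹ := by
  rw [bCoeff, BHat_eq_div]
  ring

lemma contDiffAt_bCoeff {τ : UpperHalfPlane} (m : ℕ) {z : ℂ} (hz : z ∉ lattice τ) :
    ContDiffAt ℝ ∞ (bCoeff τ m) z := by
  have h : bCoeff τ m = fun z => (m.factorial : ℂ)⁻¹ * BHatNum τ m z * (theta τ z)⁻¹ :=
    funext (bCoeff_eq_div τ m)
  rw [h]
  have h1 := (contDiff_BHatNum τ m).contDiffAt (x := z)
  have h2 := (contDiff_of_differentiable (differentiable_theta τ)).contDiffAt (x := z)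
  exact (contDiffAt_const.mul h1).mul (h2.inv (theta_ne_zero hz))

lemma eventually_contDiffAt_bCoeff {τ : UpperHalfPlane} (m : ℕ) {p : ℂ} (hp : p ∉ lattice τ) :
    ∀ᶠ z in 𝓝 p, ContDiffAt ℝ ∞ (bCoeff τ m) z :=
  (eventually_notMem_lattice_of_notMem hp).mono fun _ => contDiffAt_bCoeff m

lemma bCoeff_zero {τ : UpperHalfPlane} {z : ℂ} (hz : z ∉ lattice τ) : bCoeff τ 0 z = 1 := by
  rw [bCoeff_eq_div, BHatNum_zero_index]
  simp [theta_ne_zero hz]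

lemma dzbar_bCoeff_succ {τ : UpperHalfPlane} (m : ℕ) {z : ℂ} (hz : z ∉ lattice τ) :
    dzbar (bCoeff τ (m + 1)) z = -((Real.pi / τ.im : ℝ) : ℂ) * bCoeff τ m z := by
  have h : bCoeff τ (m + 1) = fun z => ((m + 1).factorial : ℂ)⁻¹ *
      (BHatNum τ (m + 1) z * (theta τ z)⁻¹) := by
    funext z; rw [bCoeff_eq_div]; ring
  have h1 : DifferentiableAt ℝ (BHatNum τ (m + 1)) z :=
    (contDiff_BHatNum τ (m + 1)).differentiable (by simp) z
  have h2 : DifferentiableAt ℂ (fun z => (theta τ z)⁻¹) z :=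
    (differentiable_theta τ z).inv (theta_ne_zero hz)
  have h3 : DifferentiableAt ℝ (fun z => (theta τ z)⁻¹) z := h2.restrictScalars ℝ
  rw [h, dzbar_const_mul _ (by fun_prop), dzbar_mul h1 h3, dzbar_eq_zero h2, dzbar_BHatNum_succ,
    bCoeff_eq_div, Nat.factorial_succ]
  have h4 : (m.factorial : ℂ) ≠ 0 := by exact_mod_cast m.factorial_ne_zero
  have h5 : ((m : ℂ) + 1) ≠ 0 := by exact_mod_cast m.succ_ne_zero
  push_cast
  field_simp
  ring

lemma hasResidue_bCoeff {τ : UpperHalfPlane} (m : ℕ) {p : ℂ} (hp : p ∈ lattice τ) :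
    HasResidue (bCoeff τ m) (if m = 1 then 1 else 0) p := by
  have h0 : HasResidue (bCoeff τ m) (if m = 1 then 1 else 0) (-p + p) := by
    rw [neg_add_cancel]
    refine ⟨fun z => (m.factorial : ℂ)⁻¹ * BHatNum τ m z * (thetaDiv τ z)⁻¹, ?_, ?_, ?_⟩
    · filter_upwards [eventually_thetaDiv_ne_zero τ] with z hz
      have h1 := (contDiff_BHatNum τ m).contDiffAt (x := z)
      have h2 := (contDiff_of_differentiable (differentiable_thetaDiv τ)).contDiffAt (x := z)
      exact (contDiffAt_const.mul h1).mul (h2.inv hz)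
    · simp only [BHatNum_zero, thetaDiv_zero]
      split_ifs with h <;> simp [h]
    · refine Eventually.of_forall fun z => ?_
      rw [bCoeff_eq_div, theta_eq_mul_thetaDiv, sub_zero, mul_inv]
      ring
  have h1 := h0.comp_const_add
  have e : (fun z => bCoeff τ m (-p + z)) = bCoeff τ m := by
    funext z
    rw [add_comm, (bCoeff_periodic τ m).add_mem ((lattice τ).neg_mem hp)]
  rwa [e] at h1

lemma IsLatticePeriodic.comp_const_add {τ : UpperHalfPlane} {f : ℂ → ℂ}
    (hf : IsLatticePeriodic τ f) (x : ℂ) : IsLatticePeriodic τ fun z => f (x + z) := by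
  intro z
  simp only [← add_assoc, (hf _).1, (hf _).2, and_self]

lemma IsLatticePeriodic.comp_const_sub {τ : UpperHalfPlane} {f : ℂ → ℂ}
    (hf : IsLatticePeriodic τ f) (y : ℂ) : IsLatticePeriodic τ fun z => f (y - z) := by
  intro z
  have h1 := (hf (y - (z + 1))).1
  have h2 := (hf (y - (z + τ))).2
  rw [show y - (z + 1) + 1 = y - z by ring] at h1
  rw [show y - (z + τ) + τ = y - z by ring] at h2
  exact ⟨h1.symm, h2.symm⟩

lemma dzbar_comp_const_add (f : ℂ → ℂ) (x z : ℂ) :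
    dzbar (fun z => f (x + z)) z = dzbar f (x + z) := by
  rw [dzbar, dzbar, fderiv_comp_add_left]

lemma dzbar_comp_const_sub {f : ℂ → ℂ} {y z : ℂ} (hf : DifferentiableAt ℝ f (y - z)) :
    dzbar (fun z => f (y - z)) z = -dzbar f (y - z) := by
  have h : HasFDerivAt (fun z => f (y - z)) (-fderiv ℝ f (y - z)) z := by
    have h1 : HasFDerivAt (fun z : ℂ => y - z) (-ContinuousLinearMap.id ℝ ℂ) z :=
      (hasFDerivAt_id z).const_sub y
    have e : -fderiv ℝ f (y - z) = (fderiv ℝ f (y - z)).comp (-ContinuousLinearMap.id ℝ ℂ) := by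
      ext; simp
    rw [e]
    exact hf.hasFDerivAt.comp z h1
  rw [dzbar, dzbar, h.fderiv]
  simp
  ring

section Convolution

variable {τ : UpperHalfPlane}

lemma hasResidue_bCoeff_mul {x y p : ℂ} (hxy : x + y ∉ lattice τ) (a b : ℕ) :
    (x + p ∈ lattice τ → HasResidue (fun z => bCoeff τ a (x + z) * bCoeff τ b (y - z))
      (if a = 1 then bCoeff τ b (x + y) else 0) p) ∧
    (y - p ∈ lattice τ → HasResidue (fun z => bCoeff τ a (x + z) * bCoeff τ b (y - z))
      (if b = 1 then -bCoeff τ a (x + y) else 0) p) ∧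
    (x + p ∉ lattice τ → y - p ∉ lattice τ →
      HasResidue (fun z => bCoeff τ a (x + z) * bCoeff τ b (y - z)) 0 p) := by
  have hsum : x + p + (y - p) = x + y := by ring
  have s1 : x + p ∉ lattice τ → ∀ᶠ z in 𝓝 p, ContDiffAt ℝ ∞ (fun z => bCoeff τ a (x + z)) z := by
    intro h
    have hc : Tendsto (fun z => x + z) (𝓝 p) (𝓝 (x + p)) := (by fun_prop : Continuous _).tendsto p
    filter_upwards [hc.eventually (eventually_contDiffAt_bCoeff a h)] with z hz
    exact ContDiffAt.comp (g := bCoeff τ a) z hz (by fun_prop)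
  have s2 : y - p ∉ lattice τ → ∀ᶠ z in 𝓝 p, ContDiffAt ℝ ∞ (fun z => bCoeff τ b (y - z)) z := by
    intro h
    have hc : Tendsto (fun z => y - z) (𝓝 p) (𝓝 (y - p)) := (by fun_prop : Continuous _).tendsto p
    filter_upwards [hc.eventually (eventually_contDiffAt_bCoeff b h)] with z hz
    exact ContDiffAt.comp (g := bCoeff τ b) z hz (by fun_prop)
  refine ⟨fun h => ?_, fun h => ?_, fun h1 h2 => ?_⟩
  · have h2 : y - p ∉ lattice τ := fun h' => hxy (hsum ▸ (lattice τ).add_mem h h')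
    have := ((hasResidue_bCoeff a h).comp_const_add x).mul_contDiffAt (s2 h2)
    rw [← hsum, add_comm (x + p), (bCoeff_periodic τ b).add_mem h]
    convert this using 1
    split_ifs <;> simp
  · have h1 : x + p ∉ lattice τ := fun h' => hxy (hsum ▸ (lattice τ).add_mem h' h)
    have := ((hasResidue_bCoeff b h).comp_const_sub y).mul_contDiffAt (s1 h1)
    rw [← hsum, (bCoeff_periodic τ a).add_mem h]
    simp only [mul_comm (bCoeff τ b _)] at this
    convert this using 1
    split_ifs <;> simp
  · have h3 := s1 h1
    have h4 := s2 h2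
    refine .of_contDiffAt ?_
    filter_upwards [h3, h4] with z hz hz'
    fun_prop

lemma hasHolomorphicPole_bCoeff_mul {x y : ℂ} (hxy : x + y ∉ lattice τ) (a b : ℕ) (p : ℂ) :
    HasHolomorphicPole (fun z => bCoeff τ a (x + z) * bCoeff τ b (y - z)) 1 p := by
  obtain ⟨h1, h2, h3⟩ := hasResidue_bCoeff_mul (p := p) hxy a b
  by_cases hx : x + p ∈ lattice τ
  · exact (h1 hx).hasHolomorphicPole
  by_cases hy : y - p ∈ lattice τ
  · exact (h2 hy).hasHolomorphicPole
  exact (h3 hx hy).hasHolomorphicPole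

lemma bCoeff_mul_periodic (x y : ℂ) (a b : ℕ) :
    IsLatticePeriodic τ fun z => bCoeff τ a (x + z) * bCoeff τ b (y - z) := by
  intro z
  have h1 := (bCoeff_periodic τ a).comp_const_add x z
  have h2 := (bCoeff_periodic τ b).comp_const_sub y z
  simp only [h1.1, h1.2, h2.1, h2.2, and_self]

lemma eventually_notMem_lattice_comp (x y p : ℂ) :
    ∀ᶠ z in 𝓝[≠] p, x + z ∉ lattice τ ∧ y - z ∉ lattice τ := by
  have hc : Tendsto (fun z => x + z) (𝓝[≠] p) (𝓝[≠] (x + p)) :=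
    tendsto_nhdsWithin_of_tendsto_nhds_of_eventually_within _
      (((by fun_prop : Continuous fun z => x + z).tendsto p).mono_left nhdsWithin_le_nhds)
      (eventually_nhdsWithin_of_forall fun z h h' => h (add_left_cancel h'))
  have hd : Tendsto (fun z => y - z) (𝓝[≠] p) (𝓝[≠] (y - p)) :=
    tendsto_nhdsWithin_of_tendsto_nhds_of_eventually_within _
      (((by fun_prop : Continuous fun z => y - z).tendsto p).mono_left nhdsWithin_le_nhds)
      (eventually_nhdsWithin_of_forall fun z h h' => h (sub_right_inj.1 h'))
  exact (hc.eventually (eventually_notMem_lattice τ _)).and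
    (hd.eventually (eventually_notMem_lattice τ _))

/-- Stokes' theorem for `b_{a+1}(x + z) b_{b+1}(y - z)`, from which multiples of `b_1(x + z)` and
`b_1(y - z)` are subtracted in order to remove the residues. -/
lemma torusIntegral_bCoeff_mul_step {x y : ℂ} (hxy : x + y ∉ lattice τ) (a b : ℕ) :
    torusIntegral τ (fun z => bCoeff τ (a + 1) (x + z) * bCoeff τ b (y - z)) =
      torusIntegral τ (fun z => bCoeff τ a (x + z) * bCoeff τ (b + 1) (y - z)) -
        (if a = 0 then bCoeff τ (b + 1) (x + y) else 0) +
        (if b = 0 then bCoeff τ (a + 1) (x + y) else 0) := by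
  set κ : ℂ := ((Real.pi / τ.im : ℝ) : ℂ) with hκ
  have hκ0 : κ ≠ 0 := by
    rw [hκ]
    exact_mod_cast (div_pos Real.pi_pos τ.im_pos).ne'
  set r : ℂ := if a = 0 then bCoeff τ (b + 1) (x + y) else 0 with hr
  set s : ℂ := if b = 0 then bCoeff τ (a + 1) (x + y) else 0 with hs
  set f : ℂ → ℂ := fun z => bCoeff τ (a + 1) (x + z) * bCoeff τ (b + 1) (y - z) +
    (-r * bCoeff τ 1 (x + z) + -s * bCoeff τ 1 (y - z)) with hf
  have hper : IsLatticePeriodic τ f := by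
    intro z
    have h0 := bCoeff_mul_periodic (τ := τ) x y (a + 1) (b + 1) z
    have h1 := (bCoeff_periodic τ 1).comp_const_add x z
    have h2 := (bCoeff_periodic τ 1).comp_const_sub y z
    simp only [hf, h0.1, h0.2, h1.1, h1.2, h2.1, h2.2, and_self]
  have hsum : ∀ p, x + p + (y - p) = x + y := fun p => by ring
  have smooth1 : ∀ p, x + p ∉ lattice τ → HasResidue (fun z => bCoeff τ 1 (x + z)) 0 p :=
    fun p h => (HasResidue.of_contDiffAt (eventually_contDiffAt_bCoeff 1 h)).comp_const_add x
  have smooth2 : ∀ p, y - p ∉ lattice τ → HasResidue (fun z => bCoeff τ 1 (y - z)) 0 p :=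
    fun p h => by
      simpa using (HasResidue.of_contDiffAt (eventually_contDiffAt_bCoeff 1 h)).comp_const_sub y
  have hres : ∀ p, HasResidue f 0 p := by
    intro p
    obtain ⟨h1, h2, h3⟩ := hasResidue_bCoeff_mul (p := p) hxy (a + 1) (b + 1)
    by_cases hx : x + p ∈ lattice τ
    · have hy : y - p ∉ lattice τ := fun h' => hxy (hsum p ▸ (lattice τ).add_mem hx h')
      have := (h1 hx).add ((((hasResidue_bCoeff 1 hx).comp_const_add x).const_mul (-r)).add
        ((smooth2 p hy).const_mul (-s)))
      convert this using 1
      simp [hr]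
    by_cases hy : y - p ∈ lattice τ
    · have := (h2 hy).add (((smooth1 p hx).const_mul (-r)).add
        (((hasResidue_bCoeff 1 hy).comp_const_sub y).const_mul (-s)))
      convert this using 1
      simp only [hs, Nat.add_eq_right]
      split_ifs <;> simp
    · have := (h3 hx hy).add (((smooth1 p hx).const_mul (-r)).add ((smooth2 p hy).const_mul (-s)))
      convert this using 1
      simp
  have hstokes := torusIntegral_dzbar_eq_zero hper hres
  have hdz : ∀ p, ∀ᶠ z in 𝓝[≠] p, dzbar f z =
      (-κ * (bCoeff τ a (x + z) * bCoeff τ (b + 1) (y - z)) +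
        κ * (bCoeff τ (a + 1) (x + z) * bCoeff τ b (y - z))) + κ * (r - s) := by
    intro p
    filter_upwards [eventually_notMem_lattice_comp (τ := τ) x y p] with z ⟨hx, hy⟩
    have dx : ∀ m, DifferentiableAt ℝ (fun z => bCoeff τ m (x + z)) z := fun m =>
      DifferentiableAt.comp (g := bCoeff τ m) z
        ((contDiffAt_bCoeff m hx).differentiableAt (by simp)) (by fun_prop)
    have dy' : ∀ m, DifferentiableAt ℝ (bCoeff τ m) (y - z) := fun m =>
      (contDiffAt_bCoeff m hy).differentiableAt (by simp)
    have dy : ∀ m, DifferentiableAt ℝ (fun z => bCoeff τ m (y - z)) z := fun m =>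
      DifferentiableAt.comp (g := bCoeff τ m) z (dy' m) (by fun_prop)
    have d0 : DifferentiableAt ℝ (fun z => bCoeff τ (a + 1) (x + z) * bCoeff τ (b + 1) (y - z)) z :=
      (dx (a + 1)).fun_mul (dy (b + 1))
    have d1 : DifferentiableAt ℝ (fun z => -r * bCoeff τ 1 (x + z)) z := (dx 1).const_mul (-r)
    have d2 : DifferentiableAt ℝ (fun z => -s * bCoeff τ 1 (y - z)) z := (dy 1).const_mul (-s)
    rw [hf, dzbar_add d0 (d1.fun_add d2), dzbar_add d1 d2,
      dzbar_mul (dx _) (dy _), dzbar_const_mul _ (dx _), dzbar_const_mul _ (dy _)]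
    simp only [dzbar_comp_const_add, dzbar_comp_const_sub (dy' _), dzbar_bCoeff_succ _ hx,
      dzbar_bCoeff_succ _ hy]
    rw [bCoeff_zero hx, bCoeff_zero hy]
    ring
  rw [torusIntegral_congr hdz, torusIntegral_add
    (fun p => ((hasHolomorphicPole_bCoeff_mul hxy _ _ p).const_mul _).add
      ((hasHolomorphicPole_bCoeff_mul hxy _ _ p).const_mul _))
    (fun p => .of_contDiffAt (Eventually.of_forall fun _ => contDiffAt_const) 1),
    torusIntegral_add (fun p => (hasHolomorphicPole_bCoeff_mul hxy _ _ p).const_mul _)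
      (fun p => (hasHolomorphicPole_bCoeff_mul hxy _ _ p).const_mul _),
    torusIntegral_const_mul, torusIntegral_const_mul, torusIntegral_const] at hstokes
  apply mul_left_cancel₀ hκ0
  linear_combination hstokes

/-- Since `b_0 = 1` off the lattice, this is Stokes' theorem for a translate of `b_{b+2}`, whose pole
has no residue. -/
lemma torusIntegral_bCoeff_zero_mul {x y : ℂ} (b : ℕ) :
    torusIntegral τ (fun z => bCoeff τ 0 (x + z) * bCoeff τ (b + 1) (y - z)) = 0 := by
  set κ : ℂ := ((Real.pi / τ.im : ℝ) : ℂ) with hκ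
  have hκ0 : κ ≠ 0 := by
    rw [hκ]
    exact_mod_cast (div_pos Real.pi_pos τ.im_pos).ne'
  have hres : ∀ p, HasResidue (fun z => bCoeff τ (b + 2) (y - z)) 0 p := by
    intro p
    by_cases hy : y - p ∈ lattice τ
    · simpa using (hasResidue_bCoeff (b + 2) hy).comp_const_sub y
    · simpa using
        (HasResidue.of_contDiffAt (eventually_contDiffAt_bCoeff (b + 2) hy)).comp_const_sub y
  have hstokes := torusIntegral_dzbar_eq_zero ((bCoeff_periodic τ (b + 2)).comp_const_sub y) hres
  have hdz : ∀ p, ∀ᶠ z in 𝓝[≠] p, dzbar (fun z => bCoeff τ (b + 2) (y - z)) z =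
      κ * (bCoeff τ 0 (x + z) * bCoeff τ (b + 1) (y - z)) := by
    intro p
    filter_upwards [eventually_notMem_lattice_comp (τ := τ) x y p] with z ⟨hx, hy⟩
    rw [dzbar_comp_const_sub ((contDiffAt_bCoeff _ hy).differentiableAt (by simp)),
      dzbar_bCoeff_succ _ hy, bCoeff_zero hx]
    ring
  rw [torusIntegral_congr hdz, torusIntegral_const_mul] at hstokes
  exact (mul_eq_zero.1 hstokes).resolve_left hκ0

/-- The convolution formula `∫_E b_k(x + z) b_m(y - z) vol = -b_{k+m}(x + y)` for `k, m ≥ 1`. -/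
theorem torusIntegral_bCoeff_mul {x y : ℂ} (hxy : x + y ∉ lattice τ) (a b : ℕ) :
    torusIntegral τ (fun z => bCoeff τ (a + 1) (x + z) * bCoeff τ (b + 1) (y - z)) =
      -bCoeff τ (a + 1 + (b + 1)) (x + y) := by
  induction a generalizing b with
  | zero =>
    rw [torusIntegral_bCoeff_mul_step hxy, torusIntegral_bCoeff_zero_mul]
    simp [add_comm, add_left_comm]
  | succ a ih =>
    rw [torusIntegral_bCoeff_mul_step hxy, ih,
      show a + 1 + 1 + (b + 1) = a + 1 + (b + 1 + 1) by omega]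
    simp

end Convolution

/-! ### The logarithmic derivative of the completed theta function -/

lemma deriv_thetaDiv_zero (τ : UpperHalfPlane) : deriv (thetaDiv τ) 0 = 0 := by
  have h : (fun z => thetaDiv τ (-z)) = thetaDiv τ := funext (thetaDiv_neg τ)
  have h1 := deriv_comp_neg (thetaDiv τ) 0
  rw [h, neg_zero] at h1
  exact self_eq_neg.1 h1

lemma thetaTaylor_zero (τ : UpperHalfPlane) (z : ℂ) : thetaTaylor τ 0 z = theta τ z := by
  simp [thetaTaylor, thetaDiv_zero]

lemma thetaTaylor_one (τ : UpperHalfPlane) (z : ℂ) : thetaTaylor τ 1 z = deriv (theta τ) z := by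
  have h : deriv (fun c => (thetaDiv τ c)⁻¹) 0 = 0 := by
    have := ((differentiable_thetaDiv τ 0).hasDerivAt.inv (by simp [thetaDiv_zero])).deriv
    simpa [deriv_thetaDiv_zero] using! this
  simp [thetaTaylor, Finset.sum_range_succ, h, thetaDiv_zero]

lemma dlogThetaHat_eq_bCoeff {τ : UpperHalfPlane} {z : ℂ} (hz : z ∉ lattice τ) :
    dlogThetaHat τ z = bCoeff τ 1 z := by
  have hτ : (τ.im : ℂ) ≠ 0 := by exact_mod_cast τ.im_pos.ne'
  set E : ℂ → ℂ := fun z => cexp (((-2 * Real.pi * z.im ^ 2 / τ.im : ℝ)) : ℂ) with hE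
  have hg : HasFDerivAt (fun z : ℂ => (((-2 * Real.pi * z.im ^ 2 / τ.im : ℝ)) : ℂ))
      ((-4 * Real.pi * z.im / τ.im : ℝ) • (Complex.ofRealCLM.comp Complex.imCLM)) z := by
    have h1 : HasFDerivAt (fun z : ℂ => z.im) Complex.imCLM z := Complex.imCLM.hasFDerivAt
    have h2 : HasFDerivAt (fun z : ℂ => -2 * Real.pi * z.im ^ 2 / τ.im)
        ((-4 * Real.pi * z.im / τ.im : ℝ) • Complex.imCLM) z := by
      have := ((h1.pow 2).const_mul (-2 * Real.pi)).mul_const (τ.im)⁻¹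
      simp only [← div_eq_mul_inv] at this
      convert! this using 1
      ext; simp; ring
    have e : (-4 * Real.pi * z.im / τ.im : ℝ) • (Complex.ofRealCLM.comp Complex.imCLM) =
        Complex.ofRealCLM.comp ((-4 * Real.pi * z.im / τ.im : ℝ) • Complex.imCLM) := by
      ext; simp
    rw [e]
    exact Complex.ofRealCLM.hasFDerivAt.comp z h2
  have hEd : HasFDerivAt E (E z • ((-4 * Real.pi * z.im / τ.im : ℝ) •
      (Complex.ofRealCLM.comp Complex.imCLM))) z := hg.cexp
  have hdE : dz E z = E z * anomaly τ z := by
    have hconj : (starRingEnd ℂ) z - z = -(2 * z.im * I) := by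
      apply Complex.ext <;> simp
      ring
    rw [dz, hEd.fderiv, anomaly, hconj]
    simp
    field_simp
    ring
  have hE0 : E z ≠ 0 := Complex.exp_ne_zero _
  have hθ := theta_ne_zero hz
  have hth : thetaHat τ = fun z => theta τ z * E z := rfl
  have hb : bCoeff τ 1 z = (deriv (theta τ) z + anomaly τ z * theta τ z) / theta τ z := by
    rw [bCoeff_eq_div, BHatNum]
    simp [Finset.sum_range_succ, thetaTaylor_one, thetaTaylor_zero]
    field_simp
  rw [dlogThetaHat, hth, dz_mul ((differentiable_theta τ z).restrictScalars ℝ)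
    hEd.differentiableAt, dz_eq_deriv (differentiable_theta τ z), hdE, hb]
  field_simp

/-! ### Sums over set partitions -/

section Partitions

variable {ι : Type*} [DecidableEq ι] {s : Finset ι} {a : ι}

/-- The partition of `insert a s` obtained from a partition of `s` by adding `a` to the block `T`, or
by adding the block `{a}` if `T = ∅`. -/
def finpartitionInsert (ha : a ∉ s) (π : Finpartition s) {T : Finset ι}
    (hT : T ∈ insert ∅ π.parts) : Finpartition (insert a s) :=
  Finpartition.ofExistsUnique (insert (insert a T) (π.parts.erase T))
    (by
      intro S hS
      rcases Finset.mem_insert.1 hS with rfl | hS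
      · refine Finset.insert_subset_insert a ?_
        rcases Finset.mem_insert.1 hT with rfl | hT
        · exact Finset.empty_subset s
        · exact π.subset hT
      · exact (π.subset (Finset.mem_of_mem_erase hS)).trans (Finset.subset_insert a s))
    (by
      intro x hx
      rcases Finset.mem_insert.1 hx with rfl | hx
      · refine ⟨insert x T, ⟨Finset.mem_insert_self _ _, Finset.mem_insert_self _ _⟩, ?_⟩
        rintro S ⟨hS, hxS⟩
        rcases Finset.mem_insert.1 hS with rfl | hS
        · rfl
        · exact absurd (π.subset (Finset.mem_of_mem_erase hS) hxS) ha
      · have hxa : x ≠ a := fun h => ha (h ▸ hx)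
        obtain ⟨B, hB, hxB⟩ := π.exists_mem hx
        by_cases hBT : B = T
        · subst hBT
          refine ⟨insert a B, ⟨Finset.mem_insert_self _ _, Finset.mem_insert_of_mem hxB⟩, ?_⟩
          rintro S ⟨hS, hxS⟩
          rcases Finset.mem_insert.1 hS with rfl | hS
          · rfl
          · exact absurd (π.eq_of_mem_parts (Finset.mem_of_mem_erase hS) hB hxS hxB)
              (Finset.ne_of_mem_erase hS)
        · refine ⟨B, ⟨Finset.mem_insert_of_mem (Finset.mem_erase.2 ⟨hBT, hB⟩), hxB⟩, ?_⟩
          rintro S ⟨hS, hxS⟩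
          rcases Finset.mem_insert.1 hS with rfl | hS
          · have hxT : x ∈ T := Finset.mem_of_mem_insert_of_ne hxS hxa
            rcases Finset.mem_insert.1 hT with rfl | hT
            · simp at hxT
            · exact absurd (π.eq_of_mem_parts hB hT hxB hxT) hBT
          · exact π.eq_of_mem_parts (Finset.mem_of_mem_erase hS) hB hxS hxB)
    (by
      intro h
      rcases Finset.mem_insert.1 h with h | h
      · exact Finset.insert_ne_empty _ _ h.symm
      · exact π.empty_notMem_parts (Finset.mem_of_mem_erase h))

lemma parts_finpartitionInsert (ha : a ∉ s) (π : Finpartition s) {T : Finset ι}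
    (hT : T ∈ insert ∅ π.parts) :
    (finpartitionInsert ha π hT).parts = insert (insert a T) (π.parts.erase T) := rfl

lemma notMem_of_mem_insert_parts (ha : a ∉ s) (π : Finpartition s) {T : Finset ι}
    (hT : T ∈ insert ∅ π.parts) : a ∉ T := by
  rcases Finset.mem_insert.1 hT with rfl | hT
  · simp
  · exact fun h => ha (π.subset hT h)

/-- Every partition of `insert a s` arises exactly once by inserting `a` into a partition of `s`. -/
lemma sum_finpartition_insert {R : Type*} [CommRing R] (ha : a ∉ s) (f : Finset ι → R) :
    ∑ ρ : Finpartition (insert a s), ∏ S ∈ ρ.parts, f S =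
      ∑ π : Finpartition s, ∑ T ∈ insert ∅ π.parts,
        f (insert a T) * ∏ S ∈ π.parts.erase T, f S := by
  rw [Finset.sum_sigma']
  symm
  refine Finset.sum_bij
    (fun p hp => finpartitionInsert ha p.1 (Finset.mem_sigma.1 hp).2)
    (fun _ _ => Finset.mem_univ _) ?_ ?_ ?_
  · rintro ⟨π, T⟩ hp ⟨π', T'⟩ hp' h
    have hT := (Finset.mem_sigma.1 hp).2
    have hT' := (Finset.mem_sigma.1 hp').2
    simp only at hT hT' h
    have haT := notMem_of_mem_insert_parts ha π hT
    have haT' := notMem_of_mem_insert_parts ha π' hT'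
    have hparts : insert (insert a T) (π.parts.erase T) =
        insert (insert a T') (π'.parts.erase T') := congrArg Finpartition.parts h
    have hTT : T = T' := by
      have h1 : insert a T ∈ (finpartitionInsert ha π' hT').parts := by
        rw [← h]; exact Finset.mem_insert_self _ _
      have h2 := Finpartition.eq_of_mem_parts _ h1
        (Finset.mem_insert_self (insert a T') (π'.parts.erase T'))
        (Finset.mem_insert_self a T) (Finset.mem_insert_self a T')
      rw [← Finset.erase_insert haT, h2, Finset.erase_insert haT']
    subst hTT
    have hn : ∀ π : Finpartition s, insert a T ∉ π.parts.erase T := fun π h =>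
      ha (π.subset (Finset.mem_of_mem_erase h) (Finset.mem_insert_self a T))
    have he : π.parts.erase T = π'.parts.erase T := by
      rw [← Finset.erase_insert (hn π), hparts, Finset.erase_insert (hn π')]
    have : π.parts = π'.parts := by
      rcases Finset.mem_insert.1 hT with rfl | h1
      · rwa [Finset.erase_eq_of_notMem π.empty_notMem_parts,
          Finset.erase_eq_of_notMem π'.empty_notMem_parts] at he
      · rcases Finset.mem_insert.1 hT' with rfl | h2
        · exact absurd h1 π.empty_notMem_parts
        · rw [← Finset.insert_erase h1, he, Finset.insert_erase h2]
    have : π = π' := Finpartition.ext this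
    rw [this]
  -- surjectivity: remove `a` from its block in `ρ`
  · intro ρ _
    have haA : a ∈ ρ.part a := ρ.mem_part_self.2 (Finset.mem_insert_self a s)
    have hA : ρ.part a ∈ ρ.parts := ρ.part_mem.2 (Finset.mem_insert_self a s)
    set A := ρ.part a with hAdef
    set T := A.erase a with hT
    have hins : insert a T = A := Finset.insert_erase haA
    have hTn : T ∉ ρ.parts.erase A := by
      intro h
      have h1 := Finset.mem_of_mem_erase h
      obtain ⟨x, hx⟩ := ρ.nonempty_of_mem_parts h1
      exact Finset.ne_of_mem_erase h (ρ.eq_of_mem_parts h1 hA hx (Finset.mem_of_mem_erase hx))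
    have hnota : ∀ S ∈ ρ.parts.erase A, a ∉ S := fun S hS h =>
      Finset.ne_of_mem_erase hS (ρ.eq_of_mem_parts (Finset.mem_of_mem_erase hS) hA h haA)
    have hsub : ∀ S ∈ ρ.parts, ∀ x ∈ S, x ≠ a → x ∈ s := fun S hS x hx hxa =>
      Finset.mem_of_mem_insert_of_ne (ρ.subset hS hx) hxa
    let π : Finpartition s := Finpartition.ofExistsUnique
      ((insert T (ρ.parts.erase A)).erase ∅)
      (by
        intro S hS x hx
        rcases Finset.mem_insert.1 (Finset.mem_of_mem_erase hS) with rfl | hS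
        · exact hsub A hA x (Finset.mem_of_mem_erase hx) (Finset.ne_of_mem_erase hx)
        · exact hsub S (Finset.mem_of_mem_erase hS) x hx fun h => hnota S hS (h ▸ hx))
      (by
        intro x hx
        have hxa : x ≠ a := fun h => ha (h ▸ hx)
        obtain ⟨B, hB, hxB⟩ := ρ.exists_mem (Finset.mem_insert_of_mem hx)
        by_cases hBA : B = A
        · subst hBA
          have hxT : x ∈ T := Finset.mem_erase.2 ⟨hxa, hxB⟩
          refine ⟨T, ⟨Finset.mem_erase.2 ⟨Finset.ne_empty_of_mem hxT,
            Finset.mem_insert_self _ _⟩, hxT⟩, ?_⟩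
          rintro S ⟨hS, hxS⟩
          rcases Finset.mem_insert.1 (Finset.mem_of_mem_erase hS) with rfl | hS
          · rfl
          · exact absurd (ρ.eq_of_mem_parts (Finset.mem_of_mem_erase hS) hB hxS hxB)
              (Finset.ne_of_mem_erase hS)
        · refine ⟨B, ⟨Finset.mem_erase.2 ⟨Finset.ne_empty_of_mem hxB,
            Finset.mem_insert_of_mem (Finset.mem_erase.2 ⟨hBA, hB⟩)⟩, hxB⟩, ?_⟩
          rintro S ⟨hS, hxS⟩
          rcases Finset.mem_insert.1 (Finset.mem_of_mem_erase hS) with rfl | hS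
          · exact absurd (ρ.eq_of_mem_parts hB hA hxB (Finset.mem_of_mem_erase hxS)) hBA
          · exact ρ.eq_of_mem_parts (Finset.mem_of_mem_erase hS) hB hxS hxB)
      (Finset.notMem_erase _ _)
    have hπ : π.parts = (insert T (ρ.parts.erase A)).erase ∅ := rfl
    have hTπ : T ∈ insert ∅ π.parts := by
      by_cases h : T = ∅
      · simp [h]
      · exact Finset.mem_insert_of_mem
          (hπ ▸ Finset.mem_erase.2 ⟨h, Finset.mem_insert_self _ _⟩)
    refine ⟨⟨π, T⟩, Finset.mem_sigma.2 ⟨Finset.mem_univ _, hTπ⟩, ?_⟩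
    refine Finpartition.ext ?_
    rw [parts_finpartitionInsert, hπ, hins, Finset.erase_right_comm,
      Finset.erase_insert hTn, Finset.erase_eq_of_notMem
        (fun h => ρ.empty_notMem_parts (Finset.mem_of_mem_erase h)), Finset.insert_erase hA]
  · rintro ⟨π, T⟩ hp
    have hn : insert a T ∉ π.parts.erase T := fun h =>
      ha (π.subset (Finset.mem_of_mem_erase h) (Finset.mem_insert_self a T))
    rw [parts_finpartitionInsert, Finset.prod_insert hn]

variable {A R : Type*} [AddCommMonoid A] [CommRing R]

/-- The sum over all partitions of `s` of the products of `(|S| - 1)! g(∑_{i ∈ S} x_i)` over the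
blocks `S`. The weight `(|S| - 1)!` counts the cyclic orders of `S`. -/
def partitionSum (g : A → R) (s : Finset ι) (x : ι → A) : R :=
  ∑ π : Finpartition s, ∏ S ∈ π.parts, ((S.card - 1).factorial : R) * g (∑ i ∈ S, x i)

/-- Either `a` forms a block of its own, or it is merged into some `i ∈ s`, its successor in the
cyclic order of the block. -/
lemma partitionSum_insert (g : A → R) (ha : a ∉ s) (x : ι → A) :
    partitionSum g (insert a s) x = g (x a) * partitionSum g s x +
      ∑ i ∈ s, partitionSum g s (Function.update x i (x a + x i)) := by
  simp only [partitionSum]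
  rw [sum_finpartition_insert ha, Finset.sum_comm, Finset.mul_sum, ← Finset.sum_add_distrib]
  refine Finset.sum_congr rfl fun π _ => ?_
  rw [Finset.sum_insert π.empty_notMem_parts, Finset.erase_eq_of_notMem π.empty_notMem_parts]
  congr 1
  · simp
  have hs : ∀ F : ι → R, ∑ i ∈ s, F i = ∑ T ∈ π.parts, ∑ i ∈ T, F i := by
    intro F
    have := Finset.sum_biUnion (f := F) (s := π.parts) (t := id) π.disjoint
    rwa [π.biUnion_parts] at this
  rw [hs]
  refine Finset.sum_congr rfl fun T hT => ?_
  have haT : a ∉ T := fun h => ha (π.subset hT h)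
  have hterm : ∀ i ∈ T, ∏ S ∈ π.parts, ((S.card - 1).factorial : R) *
        g (∑ j ∈ S, Function.update x i (x a + x i) j) =
      ((T.card - 1).factorial : R) * g (x a + ∑ j ∈ T, x j) *
        ∏ S ∈ π.parts.erase T, ((S.card - 1).factorial : R) * g (∑ j ∈ S, x j) := by
    intro i hi
    rw [← Finset.mul_prod_erase _ _ hT]
    congr 1
    · rw [Finset.sum_update_of_mem hi, add_assoc, Finset.sdiff_singleton_eq_erase,
        Finset.add_sum_erase _ _ hi]
    · refine Finset.prod_congr rfl fun S hS => ?_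
      have hiS : i ∉ S := fun h => Finset.ne_of_mem_erase hS
        (π.eq_of_mem_parts (Finset.mem_of_mem_erase hS) hT h hi)
      rw [Finset.sum_update_of_notMem hiS]
  rw [Finset.sum_congr rfl hterm, Finset.sum_const, nsmul_eq_mul, Finset.card_insert_of_notMem haT,
    Finset.sum_insert haT, Nat.add_sub_cancel]
  have hcard : T.card ≠ 0 := Finset.card_ne_zero.2 (π.nonempty_of_mem_parts hT)
  rw [← Nat.mul_factorial_pred hcard]
  push_cast
  ring

/-- The tuple obtained by merging the first entry into the `i`-th one of the others. -/
def mergeZero {A : Type*} [Add A] {n : ℕ} (x : Fin (n + 1) → A) (i : Fin n) : Fin n → A :=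
  Function.update (Fin.tail x) i (x 0 + x i.succ)

/-- The value of a function `F` of tuples subject to `F(x₀, x) = g(x₀) F(x) + ∑ᵢ F(x')`, where `x'`
arises from `x` by merging `x₀` into the entry `xᵢ`. -/
def mergeSum (g : A → R) : (n : ℕ) → (Fin n → A) → R
  | 0, _ => 1
  | n + 1, x => g (x 0) * mergeSum g n (Fin.tail x) +
      ∑ i, mergeSum g n (mergeZero x i)

lemma mergeSum_eq_partitionSum_map (g : A → R) (n : ℕ) (e : Fin n ↪ ι) (x : ι → A) :
    mergeSum g n (x ∘ e) = partitionSum g (Finset.univ.map e) x := by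
  induction n generalizing x with
  | zero =>
    have h : (Finset.univ : Finset (Fin 0)).map e = ∅ := by simp
    have hu : ∀ f : Finpartition (∅ : Finset ι) → R, ∑ π, f π = f (Finpartition.empty _) :=
      fun f => Fintype.sum_unique (ι := Finpartition (⊥ : Finset ι)) f
    rw [h, mergeSum, partitionSum, hu]
    exact Finset.prod_empty.symm
  | succ n ih =>
    set e' : Fin n ↪ ι := (Fin.succEmb n).trans e with he'
    have hmap : (Finset.univ : Finset (Fin (n + 1))).map e =
        insert (e 0) ((Finset.univ : Finset (Fin n)).map e') := by
      ext j
      simp [he', Fin.exists_fin_succ, eq_comm]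
    have h0 : e 0 ∉ (Finset.univ : Finset (Fin n)).map e' := by
      simp [he', Fin.succ_ne_zero]
    rw [hmap, partitionSum_insert g h0, Finset.sum_map, ← ih, mergeSum]
    congr 1
    refine Finset.sum_congr rfl fun i _ => ?_
    rw [← ih]
    congr 1
    funext j
    by_cases hj : j = i
    · subst hj
      rw [mergeZero, Function.update_self]
      exact (Function.update_self (e' j) (x (e 0) + x (e' j)) x).symm
    · have : e' j ≠ e' i := fun h => hj (e'.injective h)
      rw [mergeZero, Function.update_of_ne hj, Function.comp_apply, Function.update_of_ne this]
      rfl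

lemma mergeSum_eq_partitionSum (g : A → R) (n : ℕ) (x : Fin n → A) :
    mergeSum g n x = partitionSum g Finset.univ x := by
  have := mergeSum_eq_partitionSum_map g n (Function.Embedding.refl (Fin n)) x
  rwa [Finset.map_refl] at this

end Partitions

/-! ### Bordered determinants -/

/-- Expansion of a determinant along the row and the column through its first diagonal entry. -/
lemma det_eq_sub_sum_adjugate {R : Type*} [CommRing R] {n : ℕ}
    (M : Matrix (Fin (n + 1)) (Fin (n + 1)) R) :
    M.det = M 0 0 * (M.submatrix Fin.succ Fin.succ).det -
      ∑ i : Fin n, ∑ j : Fin n, M i.succ 0 * M 0 j.succ *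
        (M.submatrix Fin.succ Fin.succ).adjugate j i := by
  cases n with
  | zero => simp
  | succ n =>
    have hminor : ∀ j : Fin (n + 1), (M.submatrix Fin.succ j.succ.succAbove).det =
        ∑ i : Fin (n + 1), (-1) ^ (i : ℕ) * M i.succ 0 *
          ((M.submatrix Fin.succ Fin.succ).submatrix i.succAbove j.succAbove).det := by
      intro j
      rw [Matrix.det_succ_column_zero]
      refine Finset.sum_congr rfl fun i _ => ?_
      rw [Matrix.submatrix_submatrix, Matrix.submatrix_submatrix, Matrix.submatrix_apply,
        Fin.succ_succAbove_zero]
      have : j.succ.succAbove ∘ Fin.succ = Fin.succ ∘ j.succAbove :=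
        funext fun k => Fin.succ_succAbove_succ j k
      rw [this]
    rw [Matrix.det_succ_row_zero, Fin.sum_univ_succ, Finset.sum_comm, sub_eq_add_neg,
      ← Finset.sum_neg_distrib]
    congr 1
    · simp [Fin.succAbove_zero]
    · refine Finset.sum_congr rfl fun j _ => ?_
      rw [hminor, Finset.mul_sum, ← Finset.sum_neg_distrib]
      refine Finset.sum_congr rfl fun i _ => ?_
      rw [Matrix.adjugate_fin_succ_eq_det_submatrix, Fin.val_succ, pow_succ, pow_add]
      ring

lemma sum_mul_adjugate_eq_det_updateRow {R : Type*} [CommRing R] {n : ℕ}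
    (M : Matrix (Fin n) (Fin n) R) (i : Fin n) (v : Fin n → R) :
    ∑ j, v j * M.adjugate j i = (M.updateRow i v).det := by
  rw [← Matrix.cramer_transpose_apply, Matrix.cramer_eq_adjugate_mulVec,
    ← Matrix.adjugate_transpose]
  simp [Matrix.mulVec, dotProduct, mul_comm]

/-! ### Points off the lattice translates of the diagonals -/

variable {τ : UpperHalfPlane}

/-- No difference of two distinct coordinates of `z`, shifted by an element of `U`, is a lattice
point. -/
def Avoids (τ : UpperHalfPlane) {n : ℕ} (U : Finset ℂ) (z : Fin n → ℂ) : Prop :=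
  ∀ i j, i ≠ j → ∀ u ∈ U, u + z i - z j ∉ lattice τ

lemma Avoids.mono {n : ℕ} {U V : Finset ℂ} {z : Fin n → ℂ} (h : Avoids τ V z) (hUV : U ⊆ V) :
    Avoids τ U z :=
  fun i j hij u hu => h i j hij u (hUV hu)

lemma Avoids.eventually_cons {n : ℕ} {U : Finset ℂ} {z : Fin n → ℂ} (h : Avoids τ U z) (p : ℂ) :
    ∀ᶠ z₁ in 𝓝[≠] p, Avoids τ U (Fin.cons z₁ z : Fin (n + 1) → ℂ) := by
  have h1 : ∀ᶠ z₁ in 𝓝[≠] p, ∀ j : Fin n, ∀ u ∈ U,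
      (u - z j) + z₁ ∉ lattice τ ∧ (u + z j) - z₁ ∉ lattice τ := by
    rw [eventually_all]
    intro j
    rw [Finset.eventually_all]
    intro u _
    exact eventually_notMem_lattice_comp _ _ p
  filter_upwards [h1] with z₁ hz₁ i j hij u hu
  induction i using Fin.cases with
  | zero =>
    induction j using Fin.cases with
    | zero => exact absurd rfl hij
    | succ j =>
      have := (hz₁ j u hu).1
      rwa [show u - z j + z₁ = u + z₁ - z j by ring] at this
  | succ i =>
    induction j using Fin.cases with
    | zero => exact (hz₁ i u hu).2
    | succ j => exact h i j (fun h => hij (congrArg _ h)) u hu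

/-- The set is empty or a proper affine subspace. -/
lemma volume_setOf_sub_eq {n : ℕ} {i j : Fin n} (hij : i ≠ j) (c : ℂ) :
    volume {z : Fin n → ℂ | z i - z j = c} = 0 := by
  let L : (Fin n → ℂ) →ₗ[ℝ] ℂ :=
    LinearMap.proj (R := ℝ) (φ := fun _ : Fin n => ℂ) i -
      LinearMap.proj (R := ℝ) (φ := fun _ : Fin n => ℂ) j
  have hL : ∀ z, L z = z i - z j := fun z => rfl
  let s : AffineSubspace ℝ (Fin n → ℂ) := (affineSpan ℝ {c}).comap L.toAffineMap
  have hs : (s : Set (Fin n → ℂ)) = {z | z i - z j = c} := by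
    ext z
    simp [s, hL]
  rw [← hs]
  refine Measure.addHaar_affineSubspace _ s fun htop => ?_
  have hmem : ∀ z : Fin n → ℂ, z i - z j = c := by
    intro z
    have : z ∈ (s : Set (Fin n → ℂ)) := by rw [htop]; exact Set.mem_univ z
    rwa [hs] at this
  have h0 := hmem 0
  have h1 := hmem (Pi.single i 1)
  rw [← h0] at h1
  simp [hij.symm] at h1

lemma ae_avoids (τ : UpperHalfPlane) {n : ℕ} (U : Finset ℂ) :
    ∀ᵐ z : Fin n → ℂ, Avoids τ U z := by
  simp only [Avoids]
  rw [ae_all_iff]; intro i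
  rw [ae_all_iff]; intro j
  by_cases hij : i = j
  · exact Eventually.of_forall fun z h => absurd hij h
  have key : ∀ᵐ z : Fin n → ℂ, ∀ u ∈ U, ∀ p : ℤ × ℤ, z i - z j ≠ p.1 + p.2 * τ - u := by
    rw [Finset.eventually_all]
    intro u _
    rw [ae_all_iff]
    intro p
    exact measure_mono_null (fun z hz => not_not.1 hz) (volume_setOf_sub_eq hij _)
  filter_upwards [key] with z hz _ u hu
  rintro ⟨a, b, hab⟩
  refine hz u hu (a, b) ?_
  rw [← hab]
  ring

/-! ### Iterated regularized integrals -/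

/-- `I` is an iterated regularized integral of `F`, where each single integral exists for all values
of the remaining variables off finitely many families of translated diagonals. -/
def HasIterRegIntegral (τ : UpperHalfPlane) : (n : ℕ) → ((Fin n → ℂ) → ℂ) → ℂ → Prop
  | 0, F, I => F Fin.elim0 = I
  | n + 1, F, I => ∃ (G : (Fin n → ℂ) → ℂ) (U : Finset ℂ),
      (∀ z, Avoids τ U z → HasRegIntegral τ (fun z₁ => F (Fin.cons z₁ z)) (G z)) ∧
        HasIterRegIntegral τ n G I

namespace HasIterRegIntegral

variable {n : ℕ} {F F' : (Fin n → ℂ) → ℂ} {I I' : ℂ}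

lemma congr (h : HasIterRegIntegral τ n F I) {V : Finset ℂ}
    (hF : ∀ z, Avoids τ V z → F' z = F z) : HasIterRegIntegral τ n F' I := by
  cases n with
  | zero => exact (hF _ fun i => i.elim0).trans h
  | succ n =>
    obtain ⟨G, U, hG, hI⟩ := h
    refine ⟨G, U ∪ V, fun z hz => ?_, hI⟩
    refine (hG z (hz.mono Finset.subset_union_left)).congr fun p => ?_
    filter_upwards [(hz.mono Finset.subset_union_right).eventually_cons p] with z₁ hz₁
    exact hF _ hz₁

lemma add (h : HasIterRegIntegral τ n F I) (h' : HasIterRegIntegral τ n F' I') :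
    HasIterRegIntegral τ n (fun z => F z + F' z) (I + I') := by
  induction n generalizing I I' with
  | zero => exact congrArg₂ (· + ·) h h'
  | succ n ih =>
    obtain ⟨G, U, hG, hI⟩ := h
    obtain ⟨G', U', hG', hI'⟩ := h'
    exact ⟨_, U ∪ U', fun z hz => (hG z (hz.mono Finset.subset_union_left)).add
      (hG' z (hz.mono Finset.subset_union_right)), ih hI hI'⟩

lemma const_mul (h : HasIterRegIntegral τ n F I) (c : ℂ) :
    HasIterRegIntegral τ n (fun z => c * F z) (c * I) := by
  induction n generalizing I with
  | zero => exact congrArg (c * ·) h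
  | succ n ih =>
    obtain ⟨G, U, hG, hI⟩ := h
    exact ⟨_, U, fun z hz => (hG z hz).const_mul c, ih hI⟩

lemma zero (τ : UpperHalfPlane) (n : ℕ) : HasIterRegIntegral τ n (fun _ => 0) 0 := by
  induction n with
  | zero => rfl
  | succ n ih => exact ⟨_, ∅, fun _ _ => HasRegIntegral.const τ 0, ih⟩

lemma sum {ι : Type*} (s : Finset ι) {F : ι → (Fin n → ℂ) → ℂ} {I : ι → ℂ}
    (h : ∀ i ∈ s, HasIterRegIntegral τ n (F i) (I i)) :
    HasIterRegIntegral τ n (fun z => ∑ i ∈ s, F i z) (∑ i ∈ s, I i) := by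
  classical
  induction s using Finset.induction_on with
  | empty => simpa using zero τ n
  | insert a s ha ih =>
    simp only [Finset.sum_insert ha]
    exact (h a (Finset.mem_insert_self a s)).add
      (ih fun i hi => h i (Finset.mem_insert_of_mem hi))

/-- The recursive definition of `iterRegIntegral` involves the function `regIntegral` at all points,
which agrees with `G` only off the translated diagonals, whence the use of `congr`. -/
lemma iterRegIntegrable_and_eq (h : HasIterRegIntegral τ n F I) :
    IterRegIntegrable τ n F ∧ iterRegIntegral τ n F = I := by
  induction n generalizing I with
  | zero => exact ⟨trivial, h⟩
  | succ n ih =>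
    obtain ⟨G, U, hG, hI⟩ := h
    obtain ⟨h1, h2⟩ := ih (hI.congr fun z hz => (hG z hz).regIntegral_eq)
    refine ⟨⟨?_, h1⟩, h2⟩
    filter_upwards [ae_avoids τ U] with z hz
    exact (hG z hz).regIntegrable

end HasIterRegIntegral

/-! ### Integration of the determinant -/

lemma hasRegIntegral_bCoeff_mul {x y : ℂ} (hxy : x + y ∉ lattice τ) {a b : ℕ} (ha : a ≠ 0)
    (hb : b ≠ 0) :
    HasRegIntegral τ (fun z => bCoeff τ a (x + z) * bCoeff τ b (y - z))
      (-bCoeff τ (a + b) (x + y)) := by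
  obtain ⟨a, rfl⟩ := Nat.exists_eq_succ_of_ne_zero ha
  obtain ⟨b, rfl⟩ := Nat.exists_eq_succ_of_ne_zero hb
  rw [← torusIntegral_bCoeff_mul hxy a b]
  exact HasRegIntegral.of_simplePole (bCoeff_mul_periodic x y _ _)
    (hasHolomorphicPole_bCoeff_mul hxy _ _)

/-- The matrix with entries `b_{m_i}(W_i + z_i - z_j)`, for a tuple `x` of pairs `(m_i, W_i)`. It
generalizes `ZHat`, which is the case `m_i = 1`; integrating out a variable leads to larger `m_i`. -/
def bMatrix (τ : UpperHalfPlane) {n : ℕ} (x : Fin n → ℕ × ℂ) (z : Fin n → ℂ) :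
    Matrix (Fin n) (Fin n) ℂ :=
  Matrix.of fun i j => bCoeff τ (x i).1 ((x i).2 + z i - z j)

lemma bMatrix_mergeZero {n : ℕ} (x : Fin (n + 1) → ℕ × ℂ) (i : Fin n) (z : Fin n → ℂ) :
    bMatrix τ (mergeZero x i) z = (bMatrix τ (Fin.tail x) z).updateRow i fun j =>
      bCoeff τ ((x 0).1 + (x i.succ).1) ((x 0).2 - z j + ((x i.succ).2 + z i)) := by
  ext k j
  by_cases hk : k = i
  · subst hk
    rw [Matrix.updateRow_self]
    simp only [bMatrix, mergeZero, Matrix.of_apply, Function.update_self, Prod.fst_add,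
      Prod.snd_add]
    congr 1
    ring
  · rw [Matrix.updateRow_ne hk]
    simp [bMatrix, mergeZero, Function.update_of_ne hk]

/-- Integration over the first variable: the diagonal entry contributes a constant, and each product
of an entry of the first column and one of the first row is integrated by the convolution formula. -/
lemma hasRegIntegral_det_bMatrix {n : ℕ} {x : Fin (n + 1) → ℕ × ℂ} (hm : ∀ i, (x i).1 ≠ 0)
    (hW : ∀ i : Fin n, (x 0).2 + (x i.succ).2 ∉ lattice τ) {z : Fin n → ℂ}
    (hz : Avoids τ (Finset.univ.image fun i : Fin n => (x 0).2 + (x i.succ).2) z) :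
    HasRegIntegral τ (fun z₁ => (bMatrix τ x (Fin.cons z₁ z)).det)
      (bCoeff τ (x 0).1 (x 0).2 * (bMatrix τ (Fin.tail x) z).det +
        ∑ i, (bMatrix τ (mergeZero x i) z).det) := by
  set M := bMatrix τ (Fin.tail x) z with hM
  have hdet : ∀ z₁, (bMatrix τ x (Fin.cons z₁ z)).det =
      bCoeff τ (x 0).1 (x 0).2 * M.det + ∑ i, ∑ j, -M.adjugate j i *
        (bCoeff τ (x 0).1 ((x 0).2 - z j + z₁) *
          bCoeff τ (x i.succ).1 ((x i.succ).2 + z i - z₁)) := by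
    intro z₁
    have hsub : (bMatrix τ x (Fin.cons z₁ z)).submatrix Fin.succ Fin.succ = M := by
      ext i j
      simp [bMatrix, hM, Fin.tail]
    rw [det_eq_sub_sum_adjugate, hsub, sub_eq_add_neg, ← Finset.sum_neg_distrib]
    congr 1
    · simp [bMatrix]
    · refine Finset.sum_congr rfl fun i _ => ?_
      rw [← Finset.sum_neg_distrib]
      refine Finset.sum_congr rfl fun j _ => ?_
      simp only [bMatrix, Matrix.of_apply, Fin.cons_zero, Fin.cons_succ]
      rw [show (x 0).2 + z₁ - z j = (x 0).2 - z j + z₁ by ring]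
      ring
  have hval : ∀ i, (bMatrix τ (mergeZero x i) z).det = ∑ j, -M.adjugate j i *
      -bCoeff τ ((x 0).1 + (x i.succ).1) ((x 0).2 - z j + ((x i.succ).2 + z i)) := by
    intro i
    rw [bMatrix_mergeZero, ← sum_mul_adjugate_eq_det_updateRow]
    refine Finset.sum_congr rfl fun j _ => ?_
    ring
  simp only [hdet, hval]
  refine (HasRegIntegral.const τ _).add (HasRegIntegral.sum _ fun i _ =>
    HasRegIntegral.sum _ fun j _ => (hasRegIntegral_bCoeff_mul ?_ (hm 0) (hm _)).const_mul _)
  have he : (x 0).2 - z j + ((x i.succ).2 + z i) = (x 0).2 + (x i.succ).2 + z i - z j := by ring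
  rw [he]
  by_cases hij : i = j
  · subst hij
    simpa using hW i
  · exact hz i j hij _ (Finset.mem_image_of_mem _ (Finset.mem_univ i))

/-- Sums of entries of a merged tuple are sums of entries of the original tuple. -/
lemma sum_mergeZero {A : Type*} [AddCommMonoid A] {n : ℕ} (x : Fin (n + 1) → A) (i : Fin n)
    (S : Finset (Fin n)) : ∃ T : Finset (Fin (n + 1)), (S.Nonempty → T.Nonempty) ∧
      ∑ j ∈ S, mergeZero x i j = ∑ j ∈ T, x j := by
  have hmap : ∑ j ∈ S, Fin.tail x j = ∑ j ∈ S.map (Fin.succEmb n), x j := by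
    rw [Finset.sum_map]
    rfl
  by_cases hi : i ∈ S
  · refine ⟨insert 0 (S.map (Fin.succEmb n)), fun _ => Finset.insert_nonempty _ _, ?_⟩
    rw [Finset.sum_insert (by simp [Fin.succ_ne_zero]), ← hmap, mergeZero,
      Finset.sum_update_of_mem hi, add_assoc, Finset.sdiff_singleton_eq_erase,
      ← Finset.add_sum_erase _ _ hi]
    rfl
  · exact ⟨S.map (Fin.succEmb n), fun h => h.map, by
      rw [← hmap, mergeZero, Finset.sum_update_of_notMem hi]⟩

lemma hasIterRegIntegral_det_bMatrix {n : ℕ} (x : Fin n → ℕ × ℂ) (hm : ∀ i, (x i).1 ≠ 0)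
    (hx : ∀ S : Finset (Fin n), S.Nonempty → (∑ i ∈ S, x i).2 ∉ lattice τ) :
    HasIterRegIntegral τ n (fun z => (bMatrix τ x z).det)
      (mergeSum (fun p : ℕ × ℂ => bCoeff τ p.1 p.2) n x) := by
  induction n with
  | zero => exact Matrix.det_fin_zero
  | succ n ih =>
    refine ⟨_, _, fun z hz => hasRegIntegral_det_bMatrix hm (fun i => ?_) hz, ?_⟩
    · have h := hx {0, i.succ} (Finset.insert_nonempty _ _)
      rwa [Finset.sum_pair (Fin.succ_ne_zero i).symm] at h
    · refine ((ih (Fin.tail x) (fun i => hm i.succ) fun S hS => ?_).const_mul _).add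
        (HasIterRegIntegral.sum _ fun i _ => ih (mergeZero x i) (fun j => ?_) fun S hS => ?_)
      · have h := hx (S.map (Fin.succEmb n)) hS.map
        rwa [Finset.sum_map] at h
      · by_cases hj : j = i
        · subst hj
          simp [mergeZero, hm]
        · simpa [mergeZero, Function.update_of_ne hj, Fin.tail] using hm j.succ
      · obtain ⟨T, hT, h⟩ := sum_mergeZero x i S
        rw [h]
        exact hx T (hT hS)

lemma sum_one_prod {ι : Type*} (S : Finset ι) (w : ι → ℂ) :
    ∑ i ∈ S, ((1, w i) : ℕ × ℂ) = (S.card, ∑ i ∈ S, w i) := by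
  ext <;> simp [Prod.fst_sum, Prod.snd_sum]

/-- Off the translated diagonals, where no entry is singular, `ZHat` is the matrix `bMatrix` with all
`m_i` equal to `1`. -/
lemma hasIterRegIntegral_det_ZHat {n : ℕ} {w : Fin n → ℂ}
    (hw : ∀ S : Finset (Fin n), S.Nonempty → ∑ i ∈ S, w i ∉ lattice τ) :
    HasIterRegIntegral τ n (fun z => (ZHat τ w z).det)
      (mergeSum (fun p : ℕ × ℂ => bCoeff τ p.1 p.2) n fun i => (1, w i)) := by
  refine (hasIterRegIntegral_det_bMatrix (fun i => (1, w i)) (fun _ => one_ne_zero)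
    fun S hS => ?_).congr (V := Finset.univ.image w) fun z hz => ?_
  · rw [sum_one_prod]
    exact hw S hS
  · congr 1
    ext i j
    refine dlogThetaHat_eq_bCoeff ?_
    -- off the diagonal this holds by the choice of `z`, on the diagonal because `w i` is no lattice
    -- point
    by_cases hij : i = j
    · subst hij
      simpa using hw {i} (Finset.singleton_nonempty i)
    · exact hz i j hij _ (Finset.mem_image_of_mem _ (Finset.mem_univ i))

lemma partitionSum_bCoeff {ι : Type*} [DecidableEq ι] (τ : UpperHalfPlane) (s : Finset ι)
    (w : ι → ℂ) :
    partitionSum (fun p : ℕ × ℂ => bCoeff τ p.1 p.2) s (fun i => (1, w i)) =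
      ∑ π : Finpartition s, ∏ S ∈ π.parts, BHat τ S.card (∑ i ∈ S, w i) / (S.card : ℂ) := by
  refine Finset.sum_congr rfl fun π _ => Finset.prod_congr rfl fun S hS => ?_
  have hS : S.card ≠ 0 := Finset.card_ne_zero.2 (π.nonempty_of_mem_parts hS)
  have hS' : (S.card : ℂ) ≠ 0 := Nat.cast_ne_zero.2 hS
  have hf : ((S.card - 1).factorial : ℂ) ≠ 0 := Nat.cast_ne_zero.2 (Nat.factorial_ne_zero _)
  simp only [sum_one_prod, bCoeff]
  rw [← Nat.mul_factorial_pred hS]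
  push_cast
  field_simp

end EllipticCurveIntegral

end

theorem mainTheorem6 (τ : UpperHalfPlane) (n : ℕ) (w : Fin n → ℂ)
    (hw : ∀ S : Finset (Fin n), S.Nonempty →
      ∀ a b : ℤ, ∑ i ∈ S, w i ≠ (a : ℂ) + (b : ℂ) * (τ : ℂ)) :
    EllipticCurveIntegral.IterRegIntegrable τ n
        (fun z => (EllipticCurveIntegral.ZHat τ w z).det) ∧
      EllipticCurveIntegral.GHat τ w =
        ∑ π : Finpartition (Finset.univ : Finset (Fin n)),
          ∏ S ∈ π.parts,
            EllipticCurveIntegral.BHat τ S.card (∑ i ∈ S, w i) / (S.card : ℂ) := by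
  have h := EllipticCurveIntegral.hasIterRegIntegral_det_ZHat (τ := τ) (w := w)
    fun S hS ⟨a, b, hab⟩ => hw S hS a b hab
  rw [EllipticCurveIntegral.mergeSum_eq_partitionSum,
    EllipticCurveIntegral.partitionSum_bCoeff] at h
  exact h.iterRegIntegrable_and_eq
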